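/- Let $R$ be a commutative artinian ring which is self-injective (i.e. a zero-dimensional commutative Gorenstein ring), let $G$ be a finite group, and let $\iota\colon R\to RG$ be the inclusion into the group algebra, with extension of scalars $\iota^*M=RG\otimes_R M$. Let $\operatorname{stmod}RG$ be the stable category of finitely generated $RG$-modules (morphisms modulo those factoring through finitely generated projectives), triangulated by cosyzygies and short exact sequences. Let $\operatorname{stbik}RG$ be the relative stable category: the stable category of the Frobenius exact category of finitely generated $RG$-modules whose conflations are the short exact sequences that split over $R$ (so one factors out the morphisms through the objects that are projective-injective for this exact structure), triangulated by relative cosyzygies and $R$-split short exact sequences. Let $$\mathcal K=\operatorname{thick}_{\operatorname{stmod}RG}(\iota^*M \mid M \text{ a finitely generated } R\text{-module})$$ and let $\mathcal K'$ be the full subcategory of $\operatorname{stbik}RG$ with the same objects as $\mathcal K$. Then $\mathcal K'$ is a thick subcategory of $\operatorname{stbik}RG$, and the identity on finitely generated $RG$-modules induces an equivalence of triangulated categories between the Verdier quotients $$\phi\colon(\operatorname{stbik}RG)/\mathcal K'\longrightarrow(\operatorname{stmod}RG)/\mathcal K .$$ Moreover, writing $\operatorname{Thick}(\mathcal T)$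 for the lattice, ordered by inclusion, of thick subcategories of $\mathcal T$, the equivalence $\phi$ induces a lattice isomorphism $$\{\mathcal L\in\operatorname{Thick}(\operatorname{stbik}RG)\mid \mathcal K'\subseteq\mathcal L\}\;\cong\;\{\mathcal M\in\operatorname{Thick}(\operatorname{stmod}RG)\mid \mathcal K\subseteq\mathcal M\},$$ which sends $\mathcal L$ to the full subcategory of those $X$ in $\operatorname{stmod}RG$ whose image in $(\operatorname{stmod}RG)/\mathcal K$ is isomorphic to $\phi(Y)$ for some $Y\in\mathcal L$. -/

import Mathlib

open CategoryTheory

universe u v u' v'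

open scoped TensorProduct

noncomputable section

namespace StableCat

section Triangles

/-- A triangle `X ⟶ Y ⟶ Z ⟶ S X` with respect to an endofunctor `S`. -/
structure Tri {T : Type u} [Category.{v} T] (S : T ⥤ T) where
  X : T
  Y : T
  Z : T
  f : X ⟶ Y
  g : Y ⟶ Z
  h : Z ⟶ S.obj X

variable {T : Type u} [Category.{v} T] {S : T ⥤ T}

/-- Two triangles are isomorphic. -/
def Tri.Isom (t t' : Tri S) : Prop :=
  ∃ (a : t.X ≅ t'.X) (b : t.Y ≅ t'.Y) (c : t.Z ≅ t'.Z),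
    t.f ≫ b.hom = a.hom ≫ t'.f ∧ t.g ≫ c.hom = b.hom ≫ t'.g ∧
      t.h ≫ S.map a.hom = c.hom ≫ t'.h

/-- The image of a triangle under a functor `F` which commutes with the suspensions up to the
natural isomorphism `θ`. -/
def Tri.map (t : Tri S) {T' : Type u'} [Category.{v'} T'] {S' : T' ⥤ T'} (F : T ⥤ T')
    (θ : S ⋙ F ≅ F ⋙ S') : Tri S' where
  X := F.obj t.X
  Y := F.obj t.Y
  Z := F.obj t.Z
  f := F.map t.f
  g := F.map t.g
  h := F.map t.h ≫ θ.hom.app t.X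

/-- A full subcategory `P` of a triangulated category (with suspension `S` and class of
distinguished triangles `D`) is thick if it contains the zero objects and is closed under the
suspension and its inverse, under cones, and under direct summands (in particular, it is closed
under isomorphisms). -/
structure IsThick (D : Set (Tri S)) (P : ObjectProperty T) : Prop where
  zero : ∀ X, Limits.IsZero X → P X
  suspension : ∀ X, P (S.obj X) ↔ P X
  cone : ∀ t ∈ D, P t.X → P t.Y → P t.Z
  retract : ∀ X Y, Retract X Y → P Y → P X

/-- The collection of thick subcategories, ordered by inclusion. -/
def Thick (D : Set (Tri S)) : Type _ := {P : ObjectProperty T // IsThick D P}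

instance (D : Set (Tri S)) : PartialOrder (Thick D) :=
  inferInstanceAs (PartialOrder {P : ObjectProperty T // IsThick D P})

/-- Intersections of thick subcategories are thick. -/
instance (D : Set (Tri S)) : InfSet (Thick D) where
  sInf s := ⟨fun X => ∀ L ∈ s, L.1 X,
    { zero := fun X hX L _ => L.2.zero X hX
      suspension := fun X => forall₂_congr fun L _ => L.2.suspension X
      cone := fun t ht hX hY L hL => L.2.cone t ht (hX L hL) (hY L hL)
      retract := fun X Y r hY L hL => L.2.retract X Y r (hY L hL) }⟩

/-- Thick subcategories form a lattice under inclusion. -/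
instance (D : Set (Tri S)) : CompleteLattice (Thick D) :=
  completeLatticeOfInf _ fun _ =>
    ⟨fun _ hL _ hX => hX _ hL, fun _ hM X hX _ hL => hM hL X hX⟩

/-- The smallest thick subcategory containing a given family of objects. -/
def thickClosure (D : Set (Tri S)) (P : ObjectProperty T) : Thick D :=
  sInf {L | P ≤ L.1}

/-- The morphisms which have a cone in `P`. -/
def coneIn (D : Set (Tri S)) (P : ObjectProperty T) : MorphismProperty T :=
  fun X Y f => ∃ (Z : T) (g : Y ⟶ Z) (h : Z ⟶ S.obj X), (⟨X, Y, Z, f, g, h⟩ : Tri S) ∈ D ∧ P Z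

/-- The Verdier quotient: the localization at the morphisms which have a cone in `P`. -/
abbrev VerdierQuotient (D : Set (Tri S)) (P : ObjectProperty T) := (coneIn D P).Localization

/-- The quotient functor to the Verdier quotient (the identity on objects). -/
abbrev verdierQ (D : Set (Tri S)) (P : ObjectProperty T) : T ⥤ VerdierQuotient D P :=
  (coneIn D P).Q

/-- A suspension functor on the Verdier quotient, compatible with the given one via the quotient
functor. By the universal property of the localization it is unique up to a unique compatible
isomorphism. -/
structure QuotientSuspension (D : Set (Tri S)) (P : ObjectProperty T) where
  functor : VerdierQuotient D P ⥤ VerdierQuotient D P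
  comm : S ⋙ verdierQ D P ≅ verdierQ D P ⋙ functor

/-- The distinguished triangles of the Verdier quotient: those isomorphic to the image
of a distinguished triangle. -/
def QuotientSuspension.distTriangles {D : Set (Tri S)} {P : ObjectProperty T}
    (q : QuotientSuspension D P) : Set (Tri q.functor) :=
  {t | ∃ t₀ ∈ D, t.Isom (t₀.map (verdierQ D P) q.comm)}

/-- A functor between Verdier quotients is exact if it commutes with the suspensions, up to a
natural isomorphism, in such a way that distinguished triangles are sent to distinguished
triangles. -/
def IsExactFunctor {T' : Type u'} [Category.{v'} T'] {S' : T' ⥤ T'}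
    {D : Set (Tri S)} {P : ObjectProperty T} {D' : Set (Tri S')} {P' : ObjectProperty T'}
    (F : VerdierQuotient D P ⥤ VerdierQuotient D' P') : Prop :=
  ∃ (q : QuotientSuspension D P) (q' : QuotientSuspension D' P')
    (θ : q.functor ⋙ F ≅ F ⋙ q'.functor),
    ∀ t ∈ q.distTriangles, t.map F θ ∈ q'.distTriangles

end Triangles

section Frobenius

variable {A : Type u} [Category.{v} A] [Preadditive A]

/-- The projective-injective objects with respect to a class `E` of short exact sequences. -/
structure IsProjInj (E : ObjectProperty (ShortComplex A)) (P : A) : Prop where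
  lift : ∀ S, E S → ∀ f : P ⟶ S.X₃, ∃ l : P ⟶ S.X₂, l ≫ S.g = f
  extend : ∀ S, E S → ∀ f : S.X₁ ⟶ P, ∃ l : S.X₂ ⟶ P, S.f ≫ l = f

/-- Two parallel morphisms are stably equal if their difference factors through a
projective-injective object. -/
def stableRel (E : ObjectProperty (ShortComplex A)) : HomRel A := fun X Y f g =>
  ∃ (P : A) (a : X ⟶ P) (b : P ⟶ Y), IsProjInj E P ∧ f - g = a ≫ b

/-- The stable category: the quotient by the ideal of morphisms factoring through a
projective-injective object. -/
abbrev Stable (E : ObjectProperty (ShortComplex A)) := CategoryTheory.Quotient (stableRel E)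

/-- The projection to the stable category (the identity on objects). -/
abbrev toStable (E : ObjectProperty (ShortComplex A)) : A ⥤ Stable E :=
  CategoryTheory.Quotient.functor (stableRel E)

/-- A sequence `0 ⟶ X ⟶ I ⟶ C ⟶ 0` in `E` with `I` projective-injective; `C` is
then a cosyzygy of `X`. -/
structure Hull (E : ObjectProperty (ShortComplex A)) (X : A) where
  I : A
  C : A
  i : X ⟶ I
  p : I ⟶ C
  w : i ≫ p = 0
  mem : E (ShortComplex.mk i p w)
  projInj : IsProjInj E I

/-- The part of the definition of a Frobenius category which is needed to form cosyzygies: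
sequences in `E` are cokernel sequences, and every object embeds
into a projective-injective one. -/
class HasCosyzygies (E : ObjectProperty (ShortComplex A)) : Prop where
  desc : ∀ S, E S → ∀ {W : A} (k : S.X₂ ⟶ W), S.f ≫ k = 0 → ∃ l : S.X₃ ⟶ W, S.g ≫ l = k
  epi : ∀ S, E S → Epi S.g
  hull : ∀ X : A, Nonempty (Hull E X)

variable (E : ObjectProperty (ShortComplex A)) [HasCosyzygies E]

/-- A choice of an embedding into a projective-injective object. -/
def hull (X : A) : Hull E X := (HasCosyzygies.hull X).some

/-- `c : Ω⁻¹X ⟶ Ω⁻¹Y` is induced by `f : X ⟶ Y` via some morphism of sequences. -/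
def IsCosyzygyMap {X Y : A} (f : X ⟶ Y) (c : (hull E X).C ⟶ (hull E Y).C) : Prop :=
  ∃ k : (hull E X).I ⟶ (hull E Y).I,
    (hull E X).i ≫ k = f ≫ (hull E Y).i ∧ (hull E X).p ≫ c = k ≫ (hull E Y).p

theorem exists_isCosyzygyMap {X Y : A} (f : X ⟶ Y) : ∃ c, IsCosyzygyMap E f c := by
  obtain ⟨k, hk⟩ := (hull E Y).projInj.extend _ (hull E X).mem (f ≫ (hull E Y).i)
  obtain ⟨c, hc⟩ := HasCosyzygies.desc _ (hull E X).mem (k ≫ (hull E Y).p) (by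
    simp only at hk ⊢
    rw [← Category.assoc, hk, Category.assoc, (hull E Y).w, Limits.comp_zero])
  exact ⟨c, k, hk, hc⟩

variable {E} in
theorem IsCosyzygyMap.stableRel {X Y : A} {f f' : X ⟶ Y} {c c'}
    (hc : IsCosyzygyMap E f c) (hc' : IsCosyzygyMap E f' c') (h : stableRel E f f') :
    stableRel E c c' := by
  obtain ⟨k, hk, hkc⟩ := hc
  obtain ⟨k', hk', hkc'⟩ := hc'
  obtain ⟨P, a, b, hP, hab⟩ := h
  obtain ⟨l, hl⟩ := hP.extend _ (hull E X).mem a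
  simp only at hl
  obtain ⟨n, hn⟩ := HasCosyzygies.desc _ (hull E X).mem (k - k' - l ≫ b ≫ (hull E Y).i) (by
    simp only [Preadditive.comp_sub]
    rw [hk, hk', reassoc_of% hl, ← Preadditive.sub_comp, hab, Category.assoc, sub_self])
  simp only at hn
  refine ⟨_, n, (hull E Y).p, (hull E Y).projInj, ?_⟩
  have := HasCosyzygies.epi _ (hull E X).mem
  simp only at this
  rw [← cancel_epi (hull E X).p, Preadditive.comp_sub, hkc, hkc', ← Category.assoc, hn]
  simp [Preadditive.sub_comp, (hull E Y).w]

theorem stableRel_refl {X Y : A} (f : X ⟶ Y) : stableRel E f f :=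
  ⟨_, 0, 0, (hull E X).projInj, by simp⟩

/-- A choice of an induced morphism on cosyzygies. -/
def cosyzygyMap {X Y : A} (f : X ⟶ Y) : (hull E X).C ⟶ (hull E Y).C :=
  (exists_isCosyzygyMap E f).choose

theorem isCosyzygyMap_cosyzygyMap {X Y : A} (f : X ⟶ Y) :
    IsCosyzygyMap E f (cosyzygyMap E f) :=
  (exists_isCosyzygyMap E f).choose_spec

/-- The cosyzygy as a functor to the stable category. -/
def cosyzygyFunctor : A ⥤ Stable E where
  obj X := (toStable E).obj (hull E X).C
  map f := (toStable E).map (cosyzygyMap E f)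
  map_id X := by
    rw [← (toStable E).map_id]
    exact CategoryTheory.Quotient.sound _ ((isCosyzygyMap_cosyzygyMap E (𝟙 X)).stableRel
      ⟨𝟙 _, by simp, by simp⟩ (stableRel_refl E _))
  map_comp {X Y Z} f g := by
    rw [← (toStable E).map_comp]
    obtain ⟨k, hk, hkc⟩ := isCosyzygyMap_cosyzygyMap E f
    obtain ⟨k', hk', hkc'⟩ := isCosyzygyMap_cosyzygyMap E g
    exact CategoryTheory.Quotient.sound _ ((isCosyzygyMap_cosyzygyMap E (f ≫ g)).stableRel
      ⟨k ≫ k', by rw [reassoc_of% hk, hk', Category.assoc],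
        by rw [reassoc_of% hkc, hkc', Category.assoc]⟩ (stableRel_refl E _))

/-- The suspension functor of the stable category, given by taking cosyzygies. -/
def suspension : Stable E ⥤ Stable E :=
  CategoryTheory.Quotient.lift _ (cosyzygyFunctor E) fun _ _ f g h =>
    CategoryTheory.Quotient.sound _
      ((isCosyzygyMap_cosyzygyMap E f).stableRel (isCosyzygyMap_cosyzygyMap E g) h)

/-- The triangle `X ⟶ Y ⟶ Z ⟶ ΣX` of a sequence `0 ⟶ X ⟶ Y ⟶ Z ⟶ 0`, where
the last morphism is `-c` for a given `c : Z ⟶ Ω⁻¹X`. -/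
def standardTriangle (S : ShortComplex A) (c : S.X₃ ⟶ (hull E S.X₁).C) : Tri (suspension E) where
  X := (toStable E).obj S.X₁
  Y := (toStable E).obj S.X₂
  Z := (toStable E).obj S.X₃
  f := (toStable E).map S.f
  g := (toStable E).map S.g
  h := (toStable E).map (-c)

/-- The distinguished triangles of the stable category: those isomorphic to the triangle
of a sequence `0 ⟶ X ⟶ Y ⟶ Z ⟶ 0` in `E` and of `c : Z ⟶ Ω⁻¹X` which fits, together with the
identity of `X`, into a morphism to the sequence `0 ⟶ X ⟶ I ⟶ Ω⁻¹X ⟶ 0`. (With the sign in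
`standardTriangle` these are the triangles isomorphic to mapping cone triangles
`X ⟶ Y ⟶ Y ⊔_X I ⟶ Ω⁻¹X`.) -/
def distTriangles : Set (Tri (suspension E)) :=
  {t | ∃ (S : ShortComplex A) (k : S.X₂ ⟶ (hull E S.X₁).I) (c : S.X₃ ⟶ (hull E S.X₁).C),
    E S ∧ S.f ≫ k = (hull E S.X₁).i ∧ S.g ≫ c = k ≫ (hull E S.X₁).p ∧
      t.Isom (standardTriangle E S c)}

end Frobenius
section Aux

open TensorProduct

variable {R : Type u} [CommRing R] {G : Type u} [Group G]

variable {N : Type u} [AddCommGroup N] [Module R N]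
  {X Y Z : Type u} [AddCommGroup X] [AddCommGroup Y] [AddCommGroup Z]
  [Module (MonoidAlgebra R G) X] [Module (MonoidAlgebra R G) Y] [Module (MonoidAlgebra R G) Z]
  [Module R X] [Module R Y] [Module R Z]
  [IsScalarTower R (MonoidAlgebra R G) X] [IsScalarTower R (MonoidAlgebra R G) Y]
  [IsScalarTower R (MonoidAlgebra R G) Z]

theorem induced_lift (g : Y →ₗ[MonoidAlgebra R G] Z)
    (H : ∀ s : N →ₗ[R] Z, ∃ s' : N →ₗ[R] Y, ∀ x, g (s' x) = s x)
    (f : MonoidAlgebra R G ⊗[R] N →ₗ[MonoidAlgebra R G] Z) :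
    ∃ f' : MonoidAlgebra R G ⊗[R] N →ₗ[MonoidAlgebra R G] Y, g ∘ₗ f' = f := by
  obtain ⟨s', hs'⟩ := H ((f.restrictScalars R) ∘ₗ (TensorProduct.mk R (MonoidAlgebra R G) N 1))
  have : SMulCommClass R (MonoidAlgebra R G) Y := IsScalarTower.to_smulCommClass
  refine ⟨AlgebraTensorModule.lift (LinearMap.toSpanSingleton (MonoidAlgebra R G) _ s'), ?_⟩
  ext n
  simp [hs']

/-- The coefficient of the identity element. -/
def coeffOne : MonoidAlgebra R G ⊗[R] N →ₗ[R] N :=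
  TensorProduct.lift
    { toFun := fun a => a.coeff 1 • LinearMap.id
      map_add' := fun a b => by simp [add_smul]
      map_smul' := fun r a => by simp [mul_smul] }

@[simp] theorem coeffOne_tmul (a : MonoidAlgebra R G) (n : N) :
    coeffOne (a ⊗ₜ[R] n) = a.coeff 1 • n := rfl

theorem coeffOne_algebraMap_smul (r : R) (z : MonoidAlgebra R G ⊗[R] N) :
    coeffOne (algebraMap R (MonoidAlgebra R G) r • z) = r • coeffOne z := by
  rw [algebraMap_smul, map_smul]

theorem linear_of_single (f : X →ₗ[R] Y)
    (h : ∀ (g : G) x, f (MonoidAlgebra.single g (1 : R) • x) =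
      MonoidAlgebra.single g (1 : R) • f x) (a : MonoidAlgebra R G) (x : X) :
    f (a • x) = a • f x := by
  induction a using MonoidAlgebra.induction_on with
  | of g => simpa using h g x
  | add a b ha hb => simp [add_smul, ha, hb]
  | smul r a ha => simp [ha]

variable [Fintype G]

/-- The `RG`-linear map `y ↦ ∑ g ⊗ t (g⁻¹ y)` attached to an `R`-linear map `t`. -/
def coind (t : Y →ₗ[R] N) : Y →ₗ[MonoidAlgebra R G] MonoidAlgebra R G ⊗[R] N :=
  let F : Y →ₗ[R] MonoidAlgebra R G ⊗[R] N :=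
    { toFun := fun y => ∑ g : G, MonoidAlgebra.single g (1 : R) ⊗ₜ[R]
        t (MonoidAlgebra.single g⁻¹ (1 : R) • y)
      map_add' := fun a b => by simp [tmul_add, Finset.sum_add_distrib]
      map_smul' := fun r a => by
        have : SMulCommClass R (MonoidAlgebra R G) Y := IsScalarTower.to_smulCommClass
        simp [Finset.smul_sum, smul_comm _ r a] }
  { F with
    map_smul' := linear_of_single F fun h y => by
      change ∑ g : G, _ = _ • ∑ g : G, _
      rw [Finset.smul_sum, ← Equiv.sum_comp (Equiv.mulLeft h)]
      refine Finset.sum_congr rfl fun g _ => ?_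
      simp [← mul_smul, smul_tmul', MonoidAlgebra.single_mul_single] }

theorem coind_apply (t : Y →ₗ[R] N) (y : Y) : coind (G := G) t y =
    ∑ g : G, MonoidAlgebra.single g (1 : R) ⊗ₜ[R] t (MonoidAlgebra.single g⁻¹ (1 : R) • y) := rfl

theorem coeffOne_coind (t : Y →ₗ[R] N) (y : Y) : coeffOne (coind (G := G) t y) = t y := by
  classical
  simp only [coind_apply, map_sum, coeffOne_tmul]
  rw [Finset.sum_eq_single 1]
  · simp [← MonoidAlgebra.one_def]
  · intro b _ hb
    simp [MonoidAlgebra.coeff_single, hb]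
  · simp

theorem coind_coeffOne (z : MonoidAlgebra R G ⊗[R] N) :
    coind (G := G) (coeffOne (R := R) (G := G) (N := N)) z = z := by
  classical
  induction z using TensorProduct.induction_on with
  | zero => simp
  | add a b ha hb => simp [ha, hb]
  | tmul a n =>
    induction a using MonoidAlgebra.induction_on with
    | add a b ha hb => simp [add_tmul, ha, hb]
    | smul r a ha =>
      rw [← smul_tmul', ← algebraMap_smul (MonoidAlgebra R G) r, map_smul, ha]
    | of h =>
      simp only [coind_apply, smul_tmul', coeffOne_tmul]
      rw [Finset.sum_eq_single h]
      · simp [MonoidAlgebra.single_mul_single]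
      · intro b _ hb
        have : b⁻¹ * h ≠ 1 := fun e => hb (by simpa [inv_mul_eq_one] using e)
        simp [MonoidAlgebra.single_mul_single, MonoidAlgebra.coeff_single, this]
      · simp

theorem coind_comp (t : Y →ₗ[R] N) (i : X →ₗ[MonoidAlgebra R G] Y) :
    coind (G := G) t ∘ₗ i = coind (G := G) (t ∘ₗ i.restrictScalars R) := by
  ext x
  simp [coind_apply]

theorem induced_extend (i : X →ₗ[MonoidAlgebra R G] Y)
    (H : ∀ t : X →ₗ[R] N, ∃ t' : Y →ₗ[R] N, ∀ x, t' (i x) = t x)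
    (f : X →ₗ[MonoidAlgebra R G] MonoidAlgebra R G ⊗[R] N) :
    ∃ f' : Y →ₗ[MonoidAlgebra R G] MonoidAlgebra R G ⊗[R] N, f' ∘ₗ i = f := by
  obtain ⟨t', ht'⟩ := H (coeffOne ∘ₗ f.restrictScalars R)
  refine ⟨coind t', ?_⟩
  have : t' ∘ₗ i.restrictScalars R = coeffOne ∘ₗ f.restrictScalars R := LinearMap.ext ht'
  rw [coind_comp, this, ← coind_comp]
  ext x
  exact coind_coeffOne _

theorem coind_injective (t : Y →ₗ[R] N) (ht : Function.Injective t) :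
    Function.Injective (coind (G := G) t) := fun a b h =>
  ht (by rw [← coeffOne_coind (G := G) t a, h, coeffOne_coind])

end Aux

section SelfInjective

variable (R : Type u) [CommRing R] [IsArtinianRing R] [Module.Injective R R]

theorem exists_functional {M : Type u} [AddCommGroup M] [Module R M] (x : M) (hx : x ≠ 0) :
    ∃ l : M →ₗ[R] R, l x ≠ 0 := by
  obtain ⟨m, hm, hIm⟩ := Ideal.exists_le_maximal (LinearMap.ker (LinearMap.toSpanSingleton R M x))
    (fun h => hx (by simpa using (Ideal.eq_top_iff_one _).1 h))
  have hmin : m ∈ (Module.annihilator R R).minimalPrimes := by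
    rw [Module.annihilator_eq_bot.2 inferInstance]
    exact ⟨⟨hm.isPrime, bot_le⟩, fun q hq hle => by
      have := hq.1
      have : q.IsMaximal := inferInstance
      exact (this.eq_of_le hm.ne_top hle).ge⟩
  obtain ⟨hp, a, ha⟩ := isAssociatedPrime_iff.1
    (Module.associatedPrimes.minimalPrimes_annihilator_subset_associatedPrimes R R hmin)
  have hm' : ∀ r ∈ m, r * a = 0 := fun r hr => by
    rw [ha] at hr
    simpa [Submodule.mem_colon_singleton] using hr
  have ha0 : a ≠ 0 := by
    rintro rfl
    refine hm.ne_top ((Ideal.eq_top_iff_one _).2 ?_)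
    rw [ha]
    simp [Submodule.mem_colon_singleton]
  let K := LinearMap.ker (LinearMap.toSpanSingleton R M x)
  obtain ⟨h, hh⟩ := Module.Injective.out (Q := R)
    (K.liftQ (LinearMap.toSpanSingleton R M x) le_rfl)
    (LinearMap.ker_eq_bot.1 (Submodule.ker_liftQ_eq_bot _ _ _ le_rfl))
    (K.liftQ (LinearMap.toSpanSingleton R R a) (fun r hr => by simpa using hm' r (hIm hr)))
  refine ⟨h, ?_⟩
  have := hh (K.mkQ 1)
  rw [Submodule.mkQ_apply, Submodule.liftQ_apply, Submodule.liftQ_apply] at this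
  simp only [LinearMap.toSpanSingleton_apply, one_smul] at this
  rwa [this]

theorem exists_embedding (M : Type u) [AddCommGroup M] [Module R M] [Module.Finite R M] :
    ∃ (n : ℕ) (j : M →ₗ[R] (Fin n → R)), Function.Injective j := by
  obtain ⟨n, s, hs⟩ := Module.Finite.exists_fin (R := R) (M := M →ₗ[R] R)
  refine ⟨n, LinearMap.pi s, (injective_iff_map_eq_zero _).2 fun x hx => ?_⟩
  by_contra h0
  obtain ⟨l, hl⟩ := exists_functional R x h0
  have : ⊤ ≤ LinearMap.ker (LinearMap.applyₗ (R := R) (M₂ := R) x) := by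
    rw [← hs, Submodule.span_le]
    rintro _ ⟨i, rfl⟩
    simpa using congrFun hx i
  exact hl (by simpa using this (Submodule.mem_top (x := l)))

end SelfInjective

section Categories

variable (R : Type u) [CommRing R] (G : Type u) [Group G]

/-- Restriction of scalars `ι_*` along the inclusion `ι : R → RG`. -/
abbrev resScalars : FGModuleCat.{u} (MonoidAlgebra R G) ⥤ ModuleCat.{u} R :=
  (ModuleCat.isFG.{u} (MonoidAlgebra R G)).ι ⋙
    ModuleCat.restrictScalars (algebraMap R (MonoidAlgebra R G))

/-- The exact structure of `mod RG`: all short exact sequences of finitely generated modules. -/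
def modExact : ObjectProperty (ShortComplex (FGModuleCat.{u} (MonoidAlgebra R G))) := fun S =>
  (S.map (ModuleCat.isFG.{u} (MonoidAlgebra R G)).ι).ShortExact

/-- The exact structure of `bik RG`: the sequences `0 → M' → M → M'' → 0` of finitely
generated `RG`-modules which are split exact as sequences of `R`-modules. -/
def bikExact : ObjectProperty (ShortComplex (FGModuleCat.{u} (MonoidAlgebra R G))) := fun S =>
  Nonempty (S.map (resScalars R G)).Splitting

/-- Extension of scalars `ι^* M = RG ⊗_R M` of a finitely generated `R`-module. -/
abbrev extScalars [Finite G] (M : FGModuleCat.{u} R) : FGModuleCat.{u} (MonoidAlgebra R G) :=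
  FGModuleCat.of (MonoidAlgebra R G) (MonoidAlgebra R G ⊗[R] M)

variable {R G}

/-- The underlying `R`-module structure of an `RG`-module. -/
abbrev resModule (M : FGModuleCat.{u} (MonoidAlgebra R G)) : Module R M :=
  Module.compHom M (algebraMap R (MonoidAlgebra R G))

attribute [local instance] resModule

theorem resModule_isScalarTower (M : FGModuleCat.{u} (MonoidAlgebra R G)) :
    IsScalarTower R (MonoidAlgebra R G) M where
  smul_assoc r a m := by
    rw [Algebra.smul_def, mul_smul]
    rfl

attribute [local instance] resModule_isScalarTower

theorem exists_desc (S : ShortComplex (FGModuleCat.{u} (MonoidAlgebra R G)))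
    (h : ∀ x, S.g.hom.hom x = 0 → ∃ y, S.f.hom.hom y = x) (hg : Function.Surjective S.g.hom.hom)
    {W : FGModuleCat.{u} (MonoidAlgebra R G)} (k : S.X₂ ⟶ W) (hk : S.f ≫ k = 0) :
    ∃ l : S.X₃ ⟶ W, S.g ≫ l = k := by
  have hle : LinearMap.ker S.g.hom.hom ≤ LinearMap.ker k.hom.hom := by
    intro x hx
    obtain ⟨y, rfl⟩ := h x hx
    exact congrArg (fun t => t.hom.hom y) hk
  refine ⟨FGModuleCat.ofHom ((LinearMap.ker S.g.hom.hom).liftQ k.hom.hom hle ∘ₗ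
    (LinearMap.quotKerEquivOfSurjective _ hg).symm.toLinearMap), ?_⟩
  ext x
  have : (LinearMap.quotKerEquivOfSurjective _ hg).symm (S.g.hom.hom x) =
      Submodule.Quotient.mk x := by
    rw [LinearEquiv.symm_apply_eq]
    rfl
  exact (congrArg ((LinearMap.ker S.g.hom.hom).liftQ k.hom.hom hle) this).trans rfl

theorem isProjInj_extScalars [Finite G]
    (E : ObjectProperty (ShortComplex (FGModuleCat.{u} (MonoidAlgebra R G))))
    (N : FGModuleCat.{u} R)
    (H₁ : ∀ S, E S → ∀ s : N →ₗ[R] S.X₃, ∃ s' : N →ₗ[R] S.X₂, ∀ x, S.g.hom.hom (s' x) = s x)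
    (H₂ : ∀ S, E S → ∀ t : S.X₁ →ₗ[R] N, ∃ t' : S.X₂ →ₗ[R] N, ∀ x, t' (S.f.hom.hom x) = t x) :
    IsProjInj E (extScalars R G N) where
  lift S hS f := by
    obtain ⟨f', hf'⟩ := induced_lift S.g.hom.hom (H₁ S hS) f.hom.hom
    exact ⟨FGModuleCat.ofHom f', FGModuleCat.hom_ext hf'⟩
  extend S hS f := by
    have := Fintype.ofFinite G
    obtain ⟨f', hf'⟩ := induced_extend S.f.hom.hom (H₂ S hS) f.hom.hom
    exact ⟨FGModuleCat.ofHom f', FGModuleCat.hom_ext hf'⟩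

/-- The sequence `X → RG ⊗ N → C` given by a map `X → N` of `R`-modules. -/
def coindComplex [Fintype G] (X : FGModuleCat.{u} (MonoidAlgebra R G)) (N : FGModuleCat.{u} R)
    (j : X →ₗ[R] N) : ShortComplex (FGModuleCat.{u} (MonoidAlgebra R G)) where
  X₁ := X
  X₂ := extScalars R G N
  X₃ := FGModuleCat.of (MonoidAlgebra R G)
    ((MonoidAlgebra R G ⊗[R] N) ⧸ LinearMap.range (coind (G := G) j))
  f := FGModuleCat.ofHom (coind j)
  g := FGModuleCat.ofHom (Submodule.mkQ _)
  zero := by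
    ext x
    exact (Submodule.Quotient.mk_eq_zero _).2 ⟨x, rfl⟩

theorem modExact_iff (S : ShortComplex (FGModuleCat.{u} (MonoidAlgebra R G))) :
    modExact R G S ↔ (∀ x, S.g.hom.hom x = 0 → ∃ y, S.f.hom.hom y = x) ∧
      Function.Injective S.f.hom.hom ∧ Function.Surjective S.g.hom.hom := by
  constructor
  · intro h
    exact ⟨(ShortComplex.moduleCat_exact_iff _).1 h.exact,
      (ModuleCat.mono_iff_injective _).1 h.mono_f, (ModuleCat.epi_iff_surjective _).1 h.epi_g⟩
  · rintro ⟨h₁, h₂, h₃⟩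
    exact
      { exact := (ShortComplex.moduleCat_exact_iff _).2 h₁
        mono_f := (ModuleCat.mono_iff_injective _).2 h₂
        epi_g := (ModuleCat.epi_iff_surjective _).2 h₃ }

theorem modExact_of_bikExact {S : ShortComplex (FGModuleCat.{u} (MonoidAlgebra R G))}
    (h : bikExact R G S) : modExact R G S := by
  obtain ⟨σ⟩ := h
  exact (modExact_iff S).2 ⟨(ShortComplex.moduleCat_exact_iff _).1 σ.shortExact.exact,
    Function.LeftInverse.injective (g := σ.r.hom) fun x => congrArg (fun t => t.hom x) σ.f_r,
    fun x => ⟨σ.s.hom x, congrArg (fun t => t.hom x) σ.s_g⟩⟩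

theorem epi_of_modExact {S : ShortComplex (FGModuleCat.{u} (MonoidAlgebra R G))}
    (h : modExact R G S) : Epi S.g where
  left_cancellation a b hab := by
    ext x
    obtain ⟨y, rfl⟩ := ((modExact_iff S).1 h).2.2 x
    exact congrArg (fun t => t.hom.hom y) hab

theorem modExact_coindComplex [Fintype G] (X : FGModuleCat.{u} (MonoidAlgebra R G))
    (N : FGModuleCat.{u} R) (j : X →ₗ[R] N) (hj : Function.Injective j) :
    modExact R G (coindComplex X N j) :=
  (modExact_iff _).2 ⟨fun _ hx => (Submodule.Quotient.mk_eq_zero _).1 hx,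
    coind_injective j hj, Submodule.mkQ_surjective _⟩

/-- Every finitely generated module embeds into a weakly projective one. -/
instance [Finite G] : HasCosyzygies (bikExact R G) where
  desc S hS _ k hk :=
    have h := (modExact_iff S).1 (modExact_of_bikExact hS)
    exists_desc S h.1 h.2.2 k hk
  epi S hS := epi_of_modExact (modExact_of_bikExact hS)
  hull X := by
    have := Fintype.ofFinite G
    have : Module.Finite R X := Module.Finite.trans (MonoidAlgebra R G) X
    let N : FGModuleCat.{u} R := FGModuleCat.of R X
    let S := coindComplex X N LinearMap.id
    have hS := modExact_coindComplex X N LinearMap.id Function.injective_id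
    let ρ : S.X₂ →ₗ[R] X :=
      { toFun := coeffOne (R := R) (G := G) (N := X)
        map_add' := map_add _
        map_smul' := coeffOne_algebraMap_smul }
    exact ⟨
      { I := S.X₂
        C := S.X₃
        i := S.f
        p := S.g
        w := S.zero
        mem := ⟨ShortComplex.Splitting.ofExactOfRetraction _
          ((ShortComplex.moduleCat_exact_iff _).2 ((modExact_iff S).1 hS).1)
          (ModuleCat.ofHom (X := S.X₂) (Y := X) ρ)
          (by ext x; exact coeffOne_coind (G := G) (LinearMap.id (R := R) (M := X)) x)
          ((ModuleCat.epi_iff_surjective _).2 ((modExact_iff S).1 hS).2.2)⟩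
        projInj := isProjInj_extScalars _ N
          (fun S hS s => ⟨hS.some.s.hom ∘ₗ s, fun x =>
            congrArg (fun t => t.hom (s x)) hS.some.s_g⟩)
          (fun S hS t => ⟨t ∘ₗ hS.some.r.hom, fun x =>
            congrArg (fun q => t (q.hom x)) hS.some.f_r⟩) }⟩

/-- For self-injective artinian `R`, every finitely generated module embeds into a finitely
generated module which is both projective and injective. -/
instance [Finite G] [IsArtinianRing R] [Module.Injective R R] : HasCosyzygies (modExact R G) where
  desc S hS _ k hk :=
    have h := (modExact_iff S).1 hS
    exists_desc S h.1 h.2.2 k hk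
  epi S hS := epi_of_modExact hS
  hull X := by
    have := Fintype.ofFinite G
    have : Module.Finite R X := Module.Finite.trans (MonoidAlgebra R G) X
    obtain ⟨n, j, hj⟩ := exists_embedding R X
    let N : FGModuleCat.{u} R := FGModuleCat.of R (Fin n → R)
    let S := coindComplex X N j
    exact ⟨
      { I := S.X₂
        C := S.X₃
        i := S.f
        p := S.g
        w := S.zero
        mem := modExact_coindComplex X N j hj
        projInj := isProjInj_extScalars _ N
          (fun S hS s => by
            obtain ⟨s', hs'⟩ := Module.projective_lifting_property
              (S.g.hom.hom.restrictScalars R) s ((modExact_iff S).1 hS).2.2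
            exact ⟨s', fun x => congrArg (fun q => q x) hs'⟩)
          (fun S hS t => Module.Injective.out (S.f.hom.hom.restrictScalars R)
            ((modExact_iff S).1 hS).2.1 t) }⟩

variable (R G)

/-- The relative stable category of `RG`. -/
abbrev Stbik := Stable (bikExact R G)

/-- The (usual) stable category of `RG`. -/
abbrev Stmod := Stable (modExact R G)

/-- The thick subcategory `𝒦` of the stable category generated by the modules `ι^* M`, for `M`
a finitely generated `R`-module. -/
def thickK [Finite G] [IsArtinianRing R] [Module.Injective R R] : Thick (distTriangles (modExact R G)) :=
  thickClosure (distTriangles (modExact R G)) fun X =>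
    ∃ M : FGModuleCat.{u} R, X = (toStable (modExact R G)).obj (extScalars R G M)

/-- The full subcategory `𝒦'` of the relative stable category with the same objects as `𝒦`. -/
def thickK' [Finite G] [IsArtinianRing R] [Module.Injective R R] : ObjectProperty (Stbik R G) := fun X =>
  (thickK R G).1 ((toStable (modExact R G)).obj X.as)

end Categories
end StableCat
end
open StableCat

noncomputable section

namespace StableCat

open Limits

/-! ### Isomorphisms of triangles. -/

section Isom

variable {T : Type u} [Category.{v} T] {S : T ⥤ T}

/-! The two stable categories differ only by objects of `𝒦`. A relatively projective module is a
summand of an induced one (`exists_retract_extScalars`), so it lies in `𝒦`. As `R`-split sequences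
are exact, the identity on modules therefore descends to a functor from the relative stable category
to `stmod/𝒦`, and this functor inverts the `R`-split inflations with cokernel in `𝒦'`.

In the other direction a monomorphism `f : X ⟶ Y` with cokernel `Z` need not be `R`-split, but it
can be corrected by a relative hull `i : X ⟶ I`: the map `(f, i) : X ⟶ Y ⊞ I` is `R`-split, and its
cokernel is an extension of `Z` by `I ∈ 𝒦` (`exists_bikExact_lift`). If `Z ∈ 𝒦`, then `(f, i)` is
inverted in `stbik/𝒦'`, and so is the projection to `Y`; hence `f` is inverted. The two induced
functors are the identity on modules, so the universal properties make them strictly inverse to each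
other. They respect suspensions because the comparison from the relative to the absolute cosyzygy is
the connecting morphism of a conflation with middle term in `𝒦`.

The same replacement shows that the thick subcategories containing `𝒦'` and those containing `𝒦` are
the same classes of modules (`isThick_bik`, `isThick_mod`). To identify this bijection with the one
induced by `φ`, it must be shown that a thick `L` containing `𝒦` is closed under isomorphism in
`stmod/𝒦` (`IsThick.of_verdierQ_iso`). This follows from a calculus of left fractions for the
inflations with cokernel in `L`.

Rotation, octahedra and homotopy pushouts are all carried out with conflations, so no triangulated
structure has to be constructed on the stable categories. -/

theorem Tri.Isom.refl (t : Tri S) : t.Isom t :=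
  ⟨Iso.refl _, Iso.refl _, Iso.refl _, by simp, by simp, by simp⟩

theorem Tri.Isom.trans {t t' t'' : Tri S} : t.Isom t' → t'.Isom t'' → t.Isom t'' := by
  rintro ⟨a, b, c, h₁, h₂, h₃⟩ ⟨a', b', c', h₁', h₂', h₃'⟩
  refine ⟨a ≪≫ a', b ≪≫ b', c ≪≫ c', ?_, ?_, ?_⟩
  · rw [Iso.trans_hom, Iso.trans_hom, reassoc_of% h₁, h₁', Category.assoc]
  · rw [Iso.trans_hom, Iso.trans_hom, reassoc_of% h₂, h₂', Category.assoc]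
  · rw [Iso.trans_hom, Iso.trans_hom, S.map_comp, reassoc_of% h₃, h₃', Category.assoc]

theorem Tri.Isom.map {t t' : Tri S} (h : t.Isom t') {T' : Type u'} [Category.{v'} T']
    {S' : T' ⥤ T'} (F : T ⥤ T') (θ : S ⋙ F ≅ F ⋙ S') : (t.map F θ).Isom (t'.map F θ) := by
  obtain ⟨a, b, c, h₁, h₂, h₃⟩ := h
  refine ⟨F.mapIso a, F.mapIso b, F.mapIso c, ?_, ?_, ?_⟩
  · simp only [Tri.map, Functor.mapIso_hom, ← F.map_comp, h₁]
  · simp only [Tri.map, Functor.mapIso_hom, ← F.map_comp, h₂]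
  · simp only [Tri.map, Functor.mapIso_hom, Category.assoc]
    have := θ.hom.naturality a.hom
    simp only [Functor.comp_map] at this
    rw [← this, ← F.map_comp_assoc, h₃, F.map_comp_assoc]

theorem IsThick.of_iso {D : Set (Tri S)} {L : ObjectProperty T} (hL : IsThick D L) {X Y : T}
    (e : X ≅ Y) (hY : L Y) : L X :=
  hL.retract X Y ⟨e.hom, e.inv, e.hom_inv_id⟩ hY

end Isom

/-! ### The additive structure of the stable category. -/

section Stable

variable {A : Type u} [Category.{v} A] [Preadditive A] {E : ObjectProperty (ShortComplex A)}

theorem IsProjInj.biprod [HasBinaryBiproducts A] {P Q : A} (hP : IsProjInj E P)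
    (hQ : IsProjInj E Q) : IsProjInj E (P ⊞ Q) where
  lift S hS f := by
    obtain ⟨a, ha⟩ := hP.lift S hS (biprod.inl ≫ f)
    obtain ⟨b, hb⟩ := hQ.lift S hS (biprod.inr ≫ f)
    exact ⟨biprod.desc a b, by ext <;> simp [ha, hb]⟩
  extend S hS f := by
    obtain ⟨a, ha⟩ := hP.extend S hS (f ≫ biprod.fst)
    obtain ⟨b, hb⟩ := hQ.extend S hS (f ≫ biprod.snd)
    exact ⟨biprod.lift a b, by ext <;> simp [ha, hb]⟩

theorem IsProjInj.exists_extend {X Y Z P : A} (hP : IsProjInj E P) {f : X ⟶ Y} {g : Y ⟶ Z}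
    {w : f ≫ g = 0} (h : E (ShortComplex.mk f g w)) (k : X ⟶ P) : ∃ l : Y ⟶ P, f ≫ l = k :=
  hP.extend _ h k

theorem isProjInj_of_isZero {P : A} (hP : IsZero P) : IsProjInj E P where
  lift _ _ _ := ⟨0, hP.eq_of_src _ _⟩
  extend _ _ _ := ⟨0, hP.eq_of_tgt _ _⟩

variable [HasCosyzygies E]

/-- A map into a projective-injective object extends along the hull of its source. Having one fixed
object to factor through makes sums of stably trivial maps stably trivial without any biproduct. -/
theorem stableRel_iff {X Y : A} (f g : X ⟶ Y) :
    stableRel E f g ↔ ∃ h : (hull E X).I ⟶ Y, f - g = (hull E X).i ≫ h := by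
  constructor
  · rintro ⟨P, a, b, hP, hab⟩
    obtain ⟨l, hl⟩ := hP.extend _ (hull E X).mem a
    exact ⟨l ≫ b, by rw [hab, ← Category.assoc, ← hl]⟩
  · rintro ⟨h, hh⟩
    exact ⟨_, _, h, (hull E X).projInj, hh⟩

variable (E) in
theorem stableRel_add {X Y : A} {f f' g g' : X ⟶ Y} (h : stableRel E f f')
    (h' : stableRel E g g') : stableRel E (f + g) (f' + g') := by
  rw [stableRel_iff] at *
  obtain ⟨a, ha⟩ := h
  obtain ⟨b, hb⟩ := h'
  exact ⟨a + b, by rw [Preadditive.comp_add, ← ha, ← hb]; abel⟩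

instance : Congruence (stableRel E) where
  equivalence :=
    { refl := stableRel_refl E
      symm := fun ⟨P, a, b, hP, h⟩ => ⟨P, a, -b, hP, by simp [← h]⟩
      trans := fun {f g k} h h' => by
        rw [stableRel_iff] at *
        obtain ⟨a, ha⟩ := h
        obtain ⟨b, hb⟩ := h'
        exact ⟨a + b, by rw [Preadditive.comp_add, ← ha, ← hb]; abel⟩ }
  comp_left f _ _ := fun ⟨P, a, b, hP, h⟩ =>
    ⟨P, f ≫ a, b, hP, by rw [← Preadditive.comp_sub, h, Category.assoc]⟩
  comp_right g := fun ⟨P, a, b, hP, h⟩ =>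
    ⟨P, a, b ≫ g, hP, by rw [← Preadditive.sub_comp, h, Category.assoc]⟩

instance : Preadditive (Stable E) :=
  Quotient.preadditive _ fun _ _ _ _ _ _ h h' => stableRel_add E h h'

instance : (toStable E).Additive :=
  Quotient.functor_additive _ fun _ _ _ _ _ _ h h' => stableRel_add E h h'

theorem toStable_map_eq_iff {X Y : A} (f g : X ⟶ Y) :
    (toStable E).map f = (toStable E).map g ↔ stableRel E f g :=
  Quotient.functor_map_eq_iff _ _ _

theorem toStable_map_eq_zero {X Y P : A} (hP : IsProjInj E P) (a : X ⟶ P) (b : P ⟶ Y) :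
    (toStable E).map (a ≫ b) = 0 := by
  rw [← (toStable E).map_zero X Y, toStable_map_eq_iff]
  exact ⟨P, a, b, hP, by simp⟩

theorem isZero_toStable {P : A} (hP : IsProjInj E P) : IsZero ((toStable E).obj P) := by
  rw [IsZero.iff_id_eq_zero, ← (toStable E).map_id, ← Category.comp_id (𝟙 P)]
  exact toStable_map_eq_zero hP _ _

/-- Adding a projective-injective summand does not change the stable isomorphism class. -/
def stableBiprodIso [HasBinaryBiproducts A] (Y : A) {P : A} (hP : IsProjInj E P) :
    (toStable E).obj Y ≅ (toStable E).obj (Y ⊞ P) where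
  hom := (toStable E).map biprod.inl
  inv := (toStable E).map biprod.fst
  hom_inv_id := by rw [← Functor.map_comp, biprod.inl_fst, CategoryTheory.Functor.map_id]
  inv_hom_id := by
    rw [← Functor.map_comp, ← CategoryTheory.Functor.map_id, ← biprod.total, Functor.map_add,
      toStable_map_eq_zero hP, add_zero]

end Stable

/-- Closure properties of an exact structure: split sequences are conflations, conflations can be
pushed out, and triangles can be rotated on the level of conflations. -/
class IsExactStructure {A : Type u} [Category.{v} A] [Preadditive A] [HasBinaryBiproducts A]
    (E : ObjectProperty (ShortComplex A)) : Prop where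
  split (X Y : A) : E (ShortComplex.mk (biprod.inl : X ⟶ X ⊞ Y) biprod.snd biprod.inl_snd)
  pushout {X I C Y : A} (i : X ⟶ I) (p : I ⟶ C) (w : i ≫ p = 0) (h : E (ShortComplex.mk i p w))
    (f : X ⟶ Y) : ∃ (P : A) (l : I ⟶ P) (j : Y ⟶ P) (q : P ⟶ C)
      (w₁ : biprod.lift f i ≫ biprod.desc j l = 0) (w₂ : j ≫ q = 0),
      E (ShortComplex.mk _ _ w₁) ∧ E (ShortComplex.mk j q w₂) ∧ l ≫ q = p ∧
        ∀ {Z : A} (g : Y ⟶ Z) (w' : f ≫ g = 0), E (ShortComplex.mk f g w') →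
          ∃ (z : P ⟶ Z) (w'' : l ≫ z = 0), E (ShortComplex.mk l z w'')
  rotate {X Y Z I C : A} (f : X ⟶ Y) (g : Y ⟶ Z) (i : X ⟶ I) (p : I ⟶ C) (w : f ≫ g = 0)
    (w' : i ≫ p = 0) (h : E (ShortComplex.mk f g w)) (h' : E (ShortComplex.mk i p w'))
    (k : Y ⟶ I) (c : Z ⟶ C) (hk : f ≫ k = i) (hc : g ≫ c = k ≫ p)
    (w'' : biprod.lift g k ≫ biprod.desc c (-p) = 0) : E (ShortComplex.mk _ _ w'')

/-! ### Closure of thick subcategories under conflations. -/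

section Thick

variable {A : Type u} [Category.{v} A] [Preadditive A] {E : ObjectProperty (ShortComplex A)}
  [HasCosyzygies E]

theorem exists_desc_of_mem {X Y Z W : A} {f : X ⟶ Y} {g : Y ⟶ Z} {w : f ≫ g = 0}
    (h : E (ShortComplex.mk f g w)) (k : Y ⟶ W) (hk : f ≫ k = 0) : ∃ l : Z ⟶ W, g ≫ l = k :=
  HasCosyzygies.desc _ h k hk

theorem epi_of_mem {X Y Z : A} {f : X ⟶ Y} {g : Y ⟶ Z} {w : f ≫ g = 0}
    (h : E (ShortComplex.mk f g w)) : Epi g :=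
  HasCosyzygies.epi _ h

theorem exists_connecting (S : ShortComplex A) (hS : E S) :
    ∃ (k : S.X₂ ⟶ (hull E S.X₁).I) (c : S.X₃ ⟶ (hull E S.X₁).C),
      S.f ≫ k = (hull E S.X₁).i ∧ S.g ≫ c = k ≫ (hull E S.X₁).p := by
  obtain ⟨k, hk⟩ := (hull E S.X₁).projInj.extend S hS (hull E S.X₁).i
  obtain ⟨c, hc⟩ := exists_desc_of_mem hS (k ≫ (hull E S.X₁).p) (by
    rw [← Category.assoc, hk, (hull E S.X₁).w])
  exact ⟨k, c, hk, hc⟩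

theorem standardTriangle_mem (S : ShortComplex A) (hS : E S) (k : S.X₂ ⟶ (hull E S.X₁).I)
    (c : S.X₃ ⟶ (hull E S.X₁).C) (hk : S.f ≫ k = (hull E S.X₁).i)
    (hc : S.g ≫ c = k ≫ (hull E S.X₁).p) : standardTriangle E S c ∈ distTriangles E :=
  ⟨S, k, c, hS, hk, hc, Tri.Isom.refl _⟩

theorem coneIn_of_conflation {L : ObjectProperty (Stable E)} (S : ShortComplex A) (hS : E S)
    (h : L ((toStable E).obj S.X₃)) : coneIn (distTriangles E) L ((toStable E).map S.f) := by
  obtain ⟨k, c, hk, hc⟩ := exists_connecting S hS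
  exact ⟨_, _, _, standardTriangle_mem S hS k c hk hc, h⟩

namespace IsThick

variable {L : ObjectProperty (Stable E)} (hL : IsThick (distTriangles E) L)
include hL

theorem exists_of_coneIn {X Y : Stable E} {f : X ⟶ Y} (hf : coneIn (distTriangles E) L f) :
    ∃ (S : ShortComplex A) (a : X ≅ (toStable E).obj S.X₁) (b : Y ≅ (toStable E).obj S.X₂), E S ∧
      L ((toStable E).obj S.X₃) ∧ f ≫ b.hom = a.hom ≫ (toStable E).map S.f := by
  obtain ⟨Z, g, h, ⟨S, k, c, hS, hk, hc, a, b, d, h₁, h₂, h₃⟩, hZ⟩ := hf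
  exact ⟨S, a, b, hS, hL.of_iso d.symm hZ, h₁⟩

theorem third (S : ShortComplex A) (hS : E S) (h₁ : L ((toStable E).obj S.X₁))
    (h₂ : L ((toStable E).obj S.X₂)) : L ((toStable E).obj S.X₃) := by
  obtain ⟨k, c, hk, hc⟩ := exists_connecting S hS
  exact hL.cone _ (standardTriangle_mem S hS k c hk hc) h₁ h₂

theorem cosyzygy_iff (X : A) :
    L ((toStable E).obj (hull E X).C) ↔ L ((toStable E).obj X) :=
  hL.suspension ((toStable E).obj X)

theorem projInj {P : A} (hP : IsProjInj E P) : L ((toStable E).obj P) :=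
  hL.zero _ (isZero_toStable hP)

/-- If the first map of a conflation is stably trivial, then the first term is up to suspension
a summand of the third term. -/
theorem of_map_eq_zero (S : ShortComplex A) (hS : E S) (h : (toStable E).map S.f = 0)
    (h₃ : L ((toStable E).obj S.X₃)) : L ((toStable E).obj S.X₁) := by
  obtain ⟨k, c, hk, hc⟩ := exists_connecting S hS
  rw [← (toStable E).map_zero, toStable_map_eq_iff, stableRel_iff] at h
  obtain ⟨h, hh⟩ := h
  rw [sub_zero] at hh
  -- Since `S.f` extends over the hull as `h`, the map `h` induces `σ` on cokernels. Then `h ≫ k`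
  -- differs from the identity by a map `m` on the cosyzygy, so `σ ≫ c` is stably the identity.
  obtain ⟨m, hm⟩ := exists_desc_of_mem (hull E S.X₁).mem (𝟙 _ - h ≫ k) (by
    rw [Preadditive.comp_sub, Category.comp_id, ← Category.assoc, ← hh, hk, sub_self])
  obtain ⟨σ, hσ⟩ := exists_desc_of_mem (hull E S.X₁).mem (h ≫ S.g) (by
    rw [← Category.assoc, ← hh, S.zero])
  have hσc : σ ≫ c = 𝟙 _ - m ≫ (hull E S.X₁).p := by
    have := epi_of_mem (hull E S.X₁).mem
    rw [← cancel_epi (hull E S.X₁).p, reassoc_of% hσ, hc, Preadditive.comp_sub, reassoc_of% hm]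
    simp [Preadditive.sub_comp]
  refine (hL.cosyzygy_iff _).1 (hL.retract _ _ ⟨(toStable E).map σ, (toStable E).map c, ?_⟩ h₃)
  rw [← Functor.map_comp, hσc, Functor.map_sub, toStable_map_eq_zero (hull E S.X₁).projInj,
    CategoryTheory.Functor.map_id, sub_zero]

variable [HasBinaryBiproducts A]

theorem biprod_iff (Y : A) {P : A} (hP : IsProjInj E P) :
    L ((toStable E).obj (Y ⊞ P)) ↔ L ((toStable E).obj Y) :=
  ⟨hL.of_iso (stableBiprodIso Y hP), hL.of_iso (stableBiprodIso Y hP).symm⟩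

variable [IsExactStructure E]

/-- Rotation gives a conflation `X₂ ⟶ X₃ ⊞ I ⟶ Ω⁻¹X₁`. Its last term lies in `L` by closure under
cones, and the suspension can be undone. -/
theorem first (S : ShortComplex A) (hS : E S) (h₂ : L ((toStable E).obj S.X₂))
    (h₃ : L ((toStable E).obj S.X₃)) : L ((toStable E).obj S.X₁) := by
  obtain ⟨k, c, hk, hc⟩ := exists_connecting S hS
  have := IsExactStructure.rotate S.f S.g _ _ S.zero _ hS (hull E S.X₁).mem k c hk hc
    (by simp [hc])
  exact (hL.cosyzygy_iff _).1
    (hL.third _ this h₂ ((hL.biprod_iff S.X₃ (hull E S.X₁).projInj).2 h₃))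

/-- In the rotated conflation the middle term is now the first one, which reduces the claim to
`first`. -/
theorem second (S : ShortComplex A) (hS : E S) (h₁ : L ((toStable E).obj S.X₁))
    (h₃ : L ((toStable E).obj S.X₃)) : L ((toStable E).obj S.X₂) := by
  obtain ⟨k, c, hk, hc⟩ := exists_connecting S hS
  have := IsExactStructure.rotate S.f S.g _ _ S.zero _ hS (hull E S.X₁).mem k c hk hc
    (by simp [hc])
  exact hL.first _ this ((hL.biprod_iff S.X₃ (hull E S.X₁).projInj).2 h₃)
    ((hL.cosyzygy_iff _).2 h₁)

theorem biprod {X Y : A} (hX : L ((toStable E).obj X)) (hY : L ((toStable E).obj Y)) :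
    L ((toStable E).obj (X ⊞ Y)) :=
  hL.second _ (IsExactStructure.split X Y) hX hY

end IsThick

end Thick

/-! ### Functors inverting the morphisms with cone in a thick subcategory. -/

section Inverting

variable {A : Type u} [Category.{v} A] [Preadditive A] {E : ObjectProperty (ShortComplex A)}
  [HasCosyzygies E] {L : ObjectProperty (Stable E)}
  {D : Type u'} [Category.{v'} D] {F : Stable E ⥤ D}

/-- A functor inverts the morphisms with cone in `L` as soon as it inverts the inflations with
cokernel in `L`. -/
theorem IsThick.isInvertedBy (hL : IsThick (distTriangles E) L)
    (h : ∀ S, E S → L ((toStable E).obj S.X₃) → IsIso (F.map ((toStable E).map S.f))) :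
    (coneIn (distTriangles E) L).IsInvertedBy F := by
  intro X Y f hf
  obtain ⟨S, a, b, hS, hS', hab⟩ := hL.exists_of_coneIn hf
  have := h S hS hS'
  have : F.map f = F.map a.hom ≫ F.map ((toStable E).map S.f) ≫ F.map b.inv := by
    rw [← F.map_comp, ← F.map_comp, ← Category.assoc, ← hab, Category.assoc, b.hom_inv_id,
      Category.comp_id]
  rw [this]
  infer_instance

variable (hF : (coneIn (distTriangles E) L).IsInvertedBy F)
include hF

theorem isIso_map_f (S : ShortComplex A) (hS : E S) (h₃ : L ((toStable E).obj S.X₃)) :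
    IsIso (F.map ((toStable E).map S.f)) :=
  hF _ (coneIn_of_conflation S hS h₃)

variable [HasBinaryBiproducts A] [IsExactStructure E]

/-- A functor which inverts the morphisms with cone in `L` identifies any two morphisms whose
difference factors through `L`. -/
theorem map_eq_of_sub_eq {X Y P : A} (hP : L ((toStable E).obj P)) (f g : X ⟶ Y) (a : X ⟶ P)
    (b : P ⟶ Y) (h : f - g = a ≫ b) :
    F.map ((toStable E).map f) = F.map ((toStable E).map g) := by
  have := isIso_map_f hF _ (IsExactStructure.split X P) hP
  -- Both `f` and `g` become `biprod.desc g b` preceded by a section of `biprod.fst : X ⊞ P ⟶ X`. As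
  -- `F` inverts this projection, the two sections have the same image.
  have h₁ : f = biprod.lift (𝟙 X) a ≫ biprod.desc g b := by
    rw [biprod.lift_desc, Category.id_comp, ← h, add_sub_cancel]
  have h₂ : g = biprod.inl ≫ biprod.desc g b := by simp
  rw [h₁]
  conv_rhs => rw [h₂]
  simp only [Functor.map_comp]
  congr 1
  have h₃ : F.map ((toStable E).map (biprod.inl : X ⟶ X ⊞ P)) ≫
      F.map ((toStable E).map biprod.fst) = 𝟙 _ := by
    rw [← Functor.map_comp, ← Functor.map_comp, biprod.inl_fst]
    simp
  have h₄ : F.map ((toStable E).map (biprod.lift (𝟙 X) a)) ≫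
      F.map ((toStable E).map biprod.fst) = 𝟙 _ := by
    rw [← Functor.map_comp, ← Functor.map_comp, biprod.lift_fst]
    simp
  have : IsIso (F.map ((toStable E).map (biprod.fst : X ⊞ P ⟶ X))) :=
    IsIso.of_isIso_fac_left h₃
  rw [← cancel_mono (F.map ((toStable E).map (biprod.fst : X ⊞ P ⟶ X))), h₃, h₄]

theorem isIso_map_fst {P : A} (hP : L ((toStable E).obj P)) (X : A) :
    IsIso (F.map ((toStable E).map (biprod.fst : X ⊞ P ⟶ X))) := by
  have := isIso_map_f hF _ (IsExactStructure.split X P) hP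
  refine IsIso.of_isIso_fac_left (f := F.map ((toStable E).map (biprod.inl : X ⟶ X ⊞ P)))
    (h := 𝟙 _) ?_
  rw [← Functor.map_comp, ← Functor.map_comp, biprod.inl_fst]
  simp

variable (hL : IsThick (distTriangles E) L)
include hL

/-- By rotation `S.g` is an inflation into `X₃ ⊞ I` with cokernel `Ω⁻¹X₁ ∈ L`, followed by the
projection away from the stably zero object `I`. -/
theorem isIso_map_g (S : ShortComplex A) (hS : E S) (h₁ : L ((toStable E).obj S.X₁)) :
    IsIso (F.map ((toStable E).map S.g)) := by
  obtain ⟨k, c, hk, hc⟩ := exists_connecting S hS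
  have h₂ := IsExactStructure.rotate S.f S.g _ _ S.zero _ hS (hull E S.X₁).mem k c hk hc
    (by simp [hc])
  have := isIso_map_f hF _ h₂ ((hL.cosyzygy_iff _).2 h₁)
  have := isIso_map_fst hF (hL.projInj (hull E S.X₁).projInj) S.X₃
  have h₃ : S.g = biprod.lift S.g k ≫ biprod.fst := by simp
  rw [h₃, Functor.map_comp, Functor.map_comp]
  infer_instance

/-- The connecting morphism of a conflation whose middle term belongs to `L` is inverted. -/
theorem isIso_map_connecting {Y P C : A} {j : Y ⟶ P} {q : P ⟶ C} {w : j ≫ q = 0}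
    (hS : E (ShortComplex.mk j q w)) (hP : L ((toStable E).obj P)) (k : P ⟶ (hull E Y).I)
    (c : C ⟶ (hull E Y).C) (hk : j ≫ k = (hull E Y).i) (hc : q ≫ c = k ≫ (hull E Y).p) :
    IsIso (F.map ((toStable E).map c)) := by
  have h₂ := IsExactStructure.rotate j q _ _ w _ hS (hull E Y).mem k c hk hc (by simp [hc])
  have := isIso_map_g hF hL _ h₂ hP
  have := isIso_map_f hF _ (IsExactStructure.split C (hull E Y).I)
    (hL.projInj (hull E Y).projInj)
  have h₃ : c = biprod.inl ≫ biprod.desc c (-(hull E Y).p) := by simp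
  rw [h₃, Functor.map_comp, Functor.map_comp]
  infer_instance

/-- The pushout of the hull of `X₁` along `S.f` is a conflation `X₂ ⟶ P ⟶ Ω⁻¹X₁` with `P` an
extension of `X₃` by a projective-injective object, so `P ∈ L`. Its connecting morphism is `-c`. -/
theorem isIso_map_cosyzygyMap (S : ShortComplex A) (hS : E S) (h₃ : L ((toStable E).obj S.X₃))
    (c : (hull E S.X₁).C ⟶ (hull E S.X₂).C) (hc : IsCosyzygyMap E S.f c) :
    IsIso (F.map ((toStable E).map c)) := by
  obtain ⟨k, hk, hkc⟩ := hc
  obtain ⟨P, l, j, q, w₁, w₂, h₁, h₂, hlq, hZ⟩ :=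
    IsExactStructure.pushout _ _ (hull E S.X₁).w (hull E S.X₁).mem S.f
  obtain ⟨z, w₃, hz⟩ := hZ S.g S.zero hS
  have hP := hL.second _ hz (hL.projInj (hull E S.X₁).projInj) h₃
  -- The pushout square anticommutes, since it comes from `biprod.lift` and `biprod.desc`; hence the
  -- sign of `k`, and then that of `c`.
  obtain ⟨k', hk'⟩ := exists_desc_of_mem h₁ (biprod.desc (hull E S.X₂).i (-k)) (by
    simp [hk])
  have hjk : j ≫ k' = (hull E S.X₂).i := by simpa using biprod.inl ≫= hk'
  have hlk : l ≫ k' = -k := by simpa using biprod.inr ≫= hk'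
  have : IsIso (F.map ((toStable E).map (-c))) := by
    refine isIso_map_connecting hF hL h₂ hP k' (-c) hjk ?_
    have := epi_of_mem h₁
    rw [← cancel_epi (biprod.desc j l)]
    ext
    · simp [reassoc_of% w₂, reassoc_of% hjk, (hull E S.X₂).w]
    · simp [reassoc_of% hlq, hkc, reassoc_of% hlk]
  have hn : IsIso (-𝟙 (hull E S.X₂).C) := ⟨-𝟙 _, by simp, by simp⟩
  have hc' : c = (-c) ≫ (-𝟙 _) := by simp
  rw [hc', Functor.map_comp, Functor.map_comp]
  infer_instance

/-- The suspension preserves the morphisms inverted by `F`. -/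
theorem isInvertedBy_suspension_comp :
    (coneIn (distTriangles E) L).IsInvertedBy (suspension E ⋙ F) :=
  hL.isInvertedBy fun S hS h₃ =>
    isIso_map_cosyzygyMap hF hL S hS h₃ _ (isCosyzygyMap_cosyzygyMap E S.f)

end Inverting

/-- Identities are inflations, and inflations compose; the latter in the form which is needed to
compose morphisms that become inflations after adding a component to some other object. -/
class HasInflationComp {A : Type u} [Category.{v} A] [Preadditive A] [HasBinaryBiproducts A]
    (E : ObjectProperty (ShortComplex A)) : Prop where
  id {X Z : A} (hZ : IsZero Z) : E (ShortComplex.mk (𝟙 X) (0 : X ⟶ Z) comp_zero)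
  comp {X Y Z I I' P P' : A} (i : X ⟶ I) (f : X ⟶ Y) (i' : Y ⟶ I') (g : Y ⟶ Z)
    (r : I ⊞ Y ⟶ P) (r' : I' ⊞ Z ⟶ P') (w : biprod.lift i f ≫ r = 0)
    (w' : biprod.lift i' g ≫ r' = 0) (h : E (ShortComplex.mk _ _ w))
    (h' : E (ShortComplex.mk _ _ w')) :
    ∃ (Q : A) (r'' : (I ⊞ I') ⊞ Z ⟶ Q)
      (w'' : biprod.lift (biprod.lift i (f ≫ i')) (f ≫ g) ≫ r'' = 0) (a : P ⟶ Q) (b : Q ⟶ P')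
      (w₃ : a ≫ b = 0), E (ShortComplex.mk _ _ w'') ∧ E (ShortComplex.mk a b w₃)

/-! ### Left fractions and the kernel of the Verdier quotient. -/

section Fractions

variable {A : Type u} [Category.{v} A] [Preadditive A] {E : ObjectProperty (ShortComplex A)}
  [HasCosyzygies E] [HasBinaryBiproducts A]

/-- The morphisms `X ⟶ Y` in the stable category which are represented by a morphism for which
`X ⟶ I ⊞ Y` is an inflation with cokernel in `L`, for some map from `X` to a projective-injective
object `I`. -/
def inflationIn (L : ObjectProperty (Stable E)) : MorphismProperty (Stable E) := fun X Y φ =>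
  ∃ (f : X.as ⟶ Y.as) (I P : A) (i : X.as ⟶ I) (r : I ⊞ Y.as ⟶ P)
    (w : biprod.lift i f ≫ r = 0), φ = (toStable E).map f ∧ IsProjInj E I ∧
      E (ShortComplex.mk _ _ w) ∧ L ((toStable E).obj P)

variable {L : ObjectProperty (Stable E)} (hL : IsThick (distTriangles E) L)
include hL

/-- The component into `I` does not matter stably, so the inflation `X ⟶ I ⊞ Y` is itself stably
trivial and `of_map_eq_zero` applies. -/
theorem of_inflationIn_zero {X Y : Stable E} (h : inflationIn L (0 : X ⟶ Y)) : L X := by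
  obtain ⟨f, I, P, i, r, w, hf, hI, h, hP⟩ := h
  have h₁ : (toStable E).map (biprod.lift i f) = 0 := by
    have h₂ : biprod.lift i f = i ≫ biprod.inl + f ≫ biprod.inr := by ext <;> simp
    rw [h₂, Functor.map_add, toStable_map_eq_zero hI, Functor.map_comp, ← hf, zero_comp, add_zero]
  exact hL.of_map_eq_zero _ h h₁ hP

variable [IsExactStructure E]

theorem inflationIn_of_conflation {X Y Z : A} {f : X ⟶ Y} {g : Y ⟶ Z} {w : f ≫ g = 0}
    (hS : E (ShortComplex.mk f g w)) (h₃ : L ((toStable E).obj Z)) :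
    inflationIn L ((toStable E).map f) := by
  -- Pushing `f` out along the hull of `X` exhibits `X ⟶ I ⊞ Y` as an inflation whose cokernel is an
  -- extension of `Z` by `I`.
  obtain ⟨P, l, j, q, w₁, w₂, h₁, h₂, -⟩ := IsExactStructure.pushout _ _ w hS (hull E X).i
  exact ⟨f, _, P, _, _, w₁, rfl, (hull E X).projInj, h₁,
    hL.second _ h₂ (hL.projInj (hull E X).projInj) h₃⟩

variable [HasInflationComp E] [HasZeroObject A]

theorem inflationIn_isMultiplicative : (inflationIn L).IsMultiplicative where
  id_mem X := by
    change inflationIn L (𝟙 ((toStable E).obj X.as))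
    rw [← (toStable E).map_id X.as]
    exact inflationIn_of_conflation hL (HasInflationComp.id (isZero_zero A))
      (hL.projInj (isProjInj_of_isZero (isZero_zero A)))
  comp_mem := by
    rintro X Y Z _ _ ⟨f, I, P, i, r, w, rfl, hI, h, hP⟩ ⟨g, I', P', i', r', w', rfl, hI', h', hP'⟩
    -- The octahedral step: the cokernel `Q` of the composite is an extension of `P'` by `P`.
    obtain ⟨Q, r'', w'', a, b, w₃, h₁, h₂⟩ := HasInflationComp.comp i f i' g r r' w w' h h'
    exact ⟨f ≫ g, _, Q, _, _, w'', ((toStable E).map_comp f g).symm, hI.biprod hI', h₁,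
      hL.second _ h₂ hP hP'⟩

theorem inflationIn_hasLeftCalculusOfFractions : (inflationIn L).HasLeftCalculusOfFractions where
  __ := inflationIn_isMultiplicative hL
  exists_leftFraction X Y φ := by
    obtain ⟨X', s, hs, φ, rfl⟩ := φ.cases
    obtain ⟨f, rfl⟩ := (toStable E).map_surjective (X := X'.as) (Y := Y.as) φ
    obtain ⟨s, I, P, i, r, w, rfl, hI, h, hP⟩ := hs
    -- The Ore square is the pushout of `X' ⟶ I ⊞ X`, whose cokernel `P` is preserved. The map `-f`
    -- compensates for the sign in the pushout.
    obtain ⟨Q, l, j, q, w₁, w₂, h₁, h₂, -⟩ := IsExactStructure.pushout _ _ w h (-f)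
    refine ⟨.mk (Y' := (toStable E).obj Q) ((toStable E).map (biprod.inr ≫ l))
      ((toStable E).map j) (inflationIn_of_conflation hL h₂ hP), ?_⟩
    have h₃ : f ≫ j = i ≫ biprod.inl ≫ l + s ≫ biprod.inr ≫ l := by
      have h₄ : biprod.lift i s = i ≫ biprod.inl + s ≫ biprod.inr := by ext <;> simp
      have h₅ : f ≫ j = biprod.lift i s ≫ l := by simpa [neg_add_eq_zero] using w₁
      rw [h₅, h₄, Preadditive.add_comp, Category.assoc, Category.assoc]
    change (toStable E).map f ≫ (toStable E).map j =
      (toStable E).map s ≫ (toStable E).map (biprod.inr ≫ l)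
    rw [← Functor.map_comp, ← Functor.map_comp, h₃, Functor.map_add, toStable_map_eq_zero hI,
      zero_add]
  ext X' X Y φ₁ φ₂ s hs h := by
    obtain ⟨f₁, rfl⟩ := (toStable E).map_surjective (X := X.as) (Y := Y.as) φ₁
    obtain ⟨f₂, rfl⟩ := (toStable E).map_surjective (X := X.as) (Y := Y.as) φ₂
    obtain ⟨s, I, P, i, r, w, rfl, hI, hS, hP⟩ := hs
    replace h : (toStable E).map (s ≫ f₁) = (toStable E).map (s ≫ f₂) := by
      rw [Functor.map_comp, Functor.map_comp]
      exact h
    rw [toStable_map_eq_iff, stableRel_iff] at h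
    obtain ⟨h, hh⟩ := h
    -- The difference `f₁ - f₂` is corrected by a map through a projective-injective object until it
    -- vanishes on `X'`. It then factors through `g : P ⟶ Y` with `P ∈ L`, and the mapping cone
    -- inclusion `j : Y ⟶ Q` of `g` stably kills it; the cokernel of `j` is `Ω⁻¹P ∈ L`.
    obtain ⟨m, hm⟩ := (hull E X'.as).projInj.exists_extend hS (hull E X'.as).i
    obtain ⟨g, hg⟩ := exists_desc_of_mem hS
        (biprod.desc 0 (f₁ - f₂) - m ≫ h) (by
      rw [Preadditive.comp_sub, reassoc_of% hm, ← hh, biprod.lift_desc]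
      simp)
    obtain ⟨Q, l, j, q, w₁, w₂, h₁, h₂, -⟩ :=
      IsExactStructure.pushout _ _ (hull E P).w (hull E P).mem g
    refine ⟨(toStable E).obj Q, (toStable E).map j,
      inflationIn_of_conflation hL h₂ ((hL.cosyzygy_iff _).2 hP), ?_⟩
    have hgj : g ≫ j = -((hull E P).i ≫ l) := by
      rw [biprod.lift_desc] at w₁
      exact eq_neg_of_add_eq_zero_left w₁
    have h₃ : f₁ - f₂ = biprod.inr ≫ r ≫ g + (biprod.inr ≫ m) ≫ h := by
      rw [hg]
      simp
    have h₄ : (f₁ - f₂) ≫ j =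
        (-(biprod.inr ≫ r ≫ (hull E P).i)) ≫ l + (biprod.inr ≫ m) ≫ h ≫ j := by
      rw [h₃]
      simp [hgj]
    change (toStable E).map f₁ ≫ (toStable E).map j = (toStable E).map f₂ ≫ (toStable E).map j
    rw [← sub_eq_zero, ← Functor.map_comp, ← Functor.map_comp, ← Functor.map_sub,
      ← Preadditive.sub_comp, h₄, Functor.map_add, toStable_map_eq_zero (hull E P).projInj,
      toStable_map_eq_zero (hull E X'.as).projInj, add_zero]

/-- If `X` and `Y` become isomorphic in the Verdier quotient by some subcategory of the thick
subcategory `L` and `Y` belongs to `L`, then so does `X`. -/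
theorem IsThick.of_verdierQ_iso {K : ObjectProperty (Stable E)} (hKL : K ≤ L) {X Y : Stable E}
    (e : (verdierQ (distTriangles E) K).obj X ≅ (verdierQ (distTriangles E) K).obj Y)
    (hY : L Y) : L X := by
  have := inflationIn_hasLeftCalculusOfFractions hL
  have hQ : (coneIn (distTriangles E) L).IsInvertedBy (inflationIn L).Q :=
    hL.isInvertedBy fun S hS h₃ =>
      MorphismProperty.Q_inverts _ _ (inflationIn_of_conflation hL hS h₃)
  have hK : (coneIn (distTriangles E) K).IsInvertedBy (inflationIn L).Q :=
    fun X Y f ⟨Z, g, h, ht, hZ⟩ => hQ f ⟨Z, g, h, ht, hKL _ hZ⟩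
  let e' : (inflationIn L).Q.obj X ≅ (inflationIn L).Q.obj Y :=
    (Localization.Construction.lift _ hK).mapIso e
  have hY' : IsZero ((inflationIn L).Q.obj Y) := by
    have h := map_eq_of_sub_eq hQ hY (𝟙 Y.as) 0 (𝟙 Y.as) (𝟙 Y.as) (by simp)
    simp only [CategoryTheory.Functor.map_id, Functor.map_zero] at h
    exact (IsZero.iff_id_eq_zero _).2 h
  have hX' : (inflationIn L).Q.map (𝟙 X) = (inflationIn L).Q.map 0 :=
    (hY'.of_iso e').eq_of_src _ _
  -- The object `Y ∈ L` becomes zero, hence so does `X`. By left fractions some `s` in `inflationIn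
  -- L` equalizes the identity and zero of `X`, which means that `s = 0`.
  obtain ⟨Z, s, hs, h⟩ := (MorphismProperty.map_eq_iff_postcomp _ (inflationIn L) _ _).1 hX'
  rw [Category.id_comp, zero_comp] at h
  subst h
  exact of_inflationIn_zero hL hs

end Fractions

/-! ### Biproducts of finitely generated modules, in terms of elements. -/

section Modules

variable {Λ : Type u} [Ring Λ]

instance : HasBinaryBiproducts (FGModuleCat.{u} Λ) where
  has_binary_biproduct X Y := HasBinaryBiproduct.mk
    { bicone :=
        { pt := FGModuleCat.of Λ (X × Y)
          fst := FGModuleCat.ofHom (LinearMap.fst Λ X Y)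
          snd := FGModuleCat.ofHom (LinearMap.snd Λ X Y)
          inl := FGModuleCat.ofHom (LinearMap.inl Λ X Y)
          inr := FGModuleCat.ofHom (LinearMap.inr Λ X Y)
          inl_fst := rfl
          inl_snd := rfl
          inr_fst := rfl
          inr_snd := rfl }
      isBilimit := isBinaryBilimitOfTotal _ (by
        refine FGModuleCat.hom_ext (LinearMap.ext fun (x : X × Y) => ?_)
        change ((x.1, 0) + (0, x.2) : X × Y) = x
        simp) }

theorem FGModuleCat.isZero_of_subsingleton (M : FGModuleCat.{u} Λ) [Subsingleton M] :
    IsZero M := by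
  rw [IsZero.iff_id_eq_zero]
  ext x
  exact Subsingleton.elim _ _

instance : HasZeroObject (FGModuleCat.{u} Λ) :=
  ⟨⟨FGModuleCat.of Λ PUnit, @FGModuleCat.isZero_of_subsingleton _ _ _
    (inferInstanceAs (Subsingleton PUnit))⟩⟩

variable {X Y Z W : FGModuleCat.{u} Λ}

theorem comp_apply (f : X ⟶ Y) (g : Y ⟶ Z) (x : X) :
    (f ≫ g).hom.hom x = g.hom.hom (f.hom.hom x) := rfl

theorem biprod_ext {x y : ↑(X ⊞ Y)}
    (h₁ : (biprod.fst : X ⊞ Y ⟶ X).hom.hom x = (biprod.fst : X ⊞ Y ⟶ X).hom.hom y)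
    (h₂ : (biprod.snd : X ⊞ Y ⟶ Y).hom.hom x = (biprod.snd : X ⊞ Y ⟶ Y).hom.hom y) : x = y := by
  have h (z : ↑(X ⊞ Y)) : (biprod.inl : X ⟶ X ⊞ Y).hom.hom ((biprod.fst : X ⊞ Y ⟶ X).hom.hom z) +
      (biprod.inr : Y ⟶ X ⊞ Y).hom.hom ((biprod.snd : X ⊞ Y ⟶ Y).hom.hom z) = z :=
    congrArg (fun t => t.hom.hom z) (biprod.total (X := X) (Y := Y))
  rw [← h x, ← h y, h₁, h₂]

/-- The element of the biproduct with given components. -/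
def biprodMk (x : X) (y : Y) : ↑(X ⊞ Y) :=
  (biprod.inl : X ⟶ X ⊞ Y).hom.hom x + (biprod.inr : Y ⟶ X ⊞ Y).hom.hom y

@[simp] theorem fst_biprodMk (x : X) (y : Y) :
    (biprod.fst : X ⊞ Y ⟶ X).hom.hom (biprodMk x y) = x := by
  have h₁ : (biprod.fst : X ⊞ Y ⟶ X).hom.hom ((biprod.inl : X ⟶ X ⊞ Y).hom.hom x) = x :=
    congrArg (fun t => t.hom.hom x) (biprod.inl_fst (X := X) (Y := Y))
  have h₂ : (biprod.fst : X ⊞ Y ⟶ X).hom.hom ((biprod.inr : Y ⟶ X ⊞ Y).hom.hom y) = 0 :=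
    congrArg (fun t => t.hom.hom y) (biprod.inr_fst (X := X) (Y := Y))
  rw [biprodMk, map_add, h₁, h₂, add_zero]

@[simp] theorem snd_biprodMk (x : X) (y : Y) :
    (biprod.snd : X ⊞ Y ⟶ Y).hom.hom (biprodMk x y) = y := by
  have h₁ : (biprod.snd : X ⊞ Y ⟶ Y).hom.hom ((biprod.inl : X ⟶ X ⊞ Y).hom.hom x) = 0 :=
    congrArg (fun t => t.hom.hom x) (biprod.inl_snd (X := X) (Y := Y))
  have h₂ : (biprod.snd : X ⊞ Y ⟶ Y).hom.hom ((biprod.inr : Y ⟶ X ⊞ Y).hom.hom y) = y :=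
    congrArg (fun t => t.hom.hom y) (biprod.inr_snd (X := X) (Y := Y))
  rw [biprodMk, map_add, h₁, h₂, zero_add]

theorem exists_biprodMk (z : ↑(X ⊞ Y)) : ∃ x y, z = biprodMk x y :=
  ⟨(biprod.fst : X ⊞ Y ⟶ X).hom.hom z, (biprod.snd : X ⊞ Y ⟶ Y).hom.hom z,
    biprod_ext (by simp) (by simp)⟩

theorem biprodMk_inj {x x' : X} {y y' : Y} : biprodMk x y = biprodMk x' y' ↔ x = x' ∧ y = y' := by
  refine ⟨fun h => ⟨?_, ?_⟩, fun h => by rw [h.1, h.2]⟩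
  · simpa using congrArg (biprod.fst : X ⊞ Y ⟶ X).hom.hom h
  · simpa using congrArg (biprod.snd : X ⊞ Y ⟶ Y).hom.hom h

theorem biprodMk_zero : biprodMk (0 : X) (0 : Y) = 0 := by simp [biprodMk]

theorem biprodMk_eq_zero {x : X} {y : Y} : biprodMk x y = 0 ↔ x = 0 ∧ y = 0 := by
  rw [← biprodMk_zero, biprodMk_inj]

theorem biprodMk_add (x x' : X) (y y' : Y) :
    biprodMk x y + biprodMk x' y' = biprodMk (x + x') (y + y') := by
  simp only [biprodMk, map_add]
  abel

theorem inl_apply (x : X) : (biprod.inl : X ⟶ X ⊞ Y).hom.hom x = biprodMk x 0 := by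
  simp [biprodMk]

theorem inr_apply (y : Y) : (biprod.inr : Y ⟶ X ⊞ Y).hom.hom y = biprodMk 0 y := by
  simp [biprodMk]

@[simp] theorem lift_apply (f : W ⟶ X) (g : W ⟶ Y) (w : W) :
    (biprod.lift f g).hom.hom w = biprodMk (f.hom.hom w) (g.hom.hom w) := by
  refine biprod_ext ?_ ?_
  · rw [← comp_apply, biprod.lift_fst, fst_biprodMk]
  · rw [← comp_apply, biprod.lift_snd, snd_biprodMk]

@[simp] theorem desc_apply (f : X ⟶ W) (g : Y ⟶ W) (x : X) (y : Y) :
    (biprod.desc f g).hom.hom (biprodMk x y) = f.hom.hom x + g.hom.hom y := by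
  rw [biprodMk, map_add, ← comp_apply, ← comp_apply, biprod.inl_desc, biprod.inr_desc]

end Modules

/-! ### The exact structure of all short exact sequences. -/

section Exact

variable {R : Type u} [CommRing R] {G : Type u} [Group G]

attribute [local instance] resModule resModule_isScalarTower

variable {X Y Z W I C P : FGModuleCat.{u} (MonoidAlgebra R G)}

theorem modExact_mk_iff {f : X ⟶ Y} {g : Y ⟶ Z} {w : f ≫ g = 0} :
    modExact R G (ShortComplex.mk f g w) ↔ (∀ y, g.hom.hom y = 0 → ∃ x, f.hom.hom x = y) ∧
      (∀ x, f.hom.hom x = 0 → x = 0) ∧ (∀ z, ∃ y, g.hom.hom y = z) := by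
  rw [modExact_iff]
  exact and_congr Iff.rfl (and_congr (injective_iff_map_eq_zero _) Iff.rfl)

/-- An `R`-linear retraction of the first map already splits an exact sequence, so relative
exactness can be checked by writing down retractions. -/
theorem bikExact_mk_iff {f : X ⟶ Y} {g : Y ⟶ Z} {w : f ≫ g = 0} :
    bikExact R G (ShortComplex.mk f g w) ↔ modExact R G (ShortComplex.mk f g w) ∧
      ∃ ρ : Y →ₗ[R] X, ∀ x, ρ (f.hom.hom x) = x := by
  constructor
  · intro h
    exact ⟨modExact_of_bikExact h, h.some.r.hom, fun x => congrArg (fun t => t.hom x) h.some.f_r⟩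
  · rintro ⟨h, ρ, hρ⟩
    exact ⟨ShortComplex.Splitting.ofExactOfRetraction _
          ((ShortComplex.moduleCat_exact_iff _).2 ((modExact_iff _).1 h).1)
          (ModuleCat.ofHom (X := Y) (Y := X) ρ) (by ext x; exact hρ x)
          ((ModuleCat.epi_iff_surjective _).2 ((modExact_iff _).1 h).2.2)⟩

theorem exists_modExact_of_injective (f : X ⟶ Y) (hf : ∀ x, f.hom.hom x = 0 → x = 0) :
    ∃ (Z : FGModuleCat.{u} (MonoidAlgebra R G)) (g : Y ⟶ Z) (w : f ≫ g = 0),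
      modExact R G (ShortComplex.mk f g w) :=
  ⟨FGModuleCat.of (MonoidAlgebra R G) (Y ⧸ LinearMap.range f.hom.hom),
    FGModuleCat.ofHom (Submodule.mkQ _),
    by ext x; exact (Submodule.Quotient.mk_eq_zero _).2 ⟨x, rfl⟩,
    modExact_mk_iff.2 ⟨fun _ hx => (Submodule.Quotient.mk_eq_zero _).1 hx, hf,
      Submodule.mkQ_surjective _⟩⟩

theorem exists_desc_of_modExact {f : X ⟶ Y} {g : Y ⟶ Z} {w : f ≫ g = 0}
    (h : modExact R G (ShortComplex.mk f g w)) (k : Y ⟶ W) (hk : f ≫ k = 0) :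
    ∃ l : Z ⟶ W, g ≫ l = k :=
  exists_desc _ ((modExact_iff _).1 h).1 ((modExact_iff _).1 h).2.2 k hk

theorem exists_linearMap_desc {f : X ⟶ Y} {g : Y ⟶ Z} {w : f ≫ g = 0}
    (h : modExact R G (ShortComplex.mk f g w)) {N : Type u} [AddCommGroup N] [Module R N]
    (k : Y →ₗ[R] N) (hk : ∀ x, k (f.hom.hom x) = 0) :
    ∃ l : Z →ₗ[R] N, ∀ y, l (g.hom.hom y) = k y := by
  obtain ⟨h₁, -, h₃⟩ := modExact_mk_iff.1 h
  let g' : Y →ₗ[R] Z := g.hom.hom.restrictScalars R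
  have hle : LinearMap.ker g' ≤ LinearMap.ker k := by
    intro y hy
    obtain ⟨x, rfl⟩ := h₁ y hy
    exact hk x
  refine ⟨(LinearMap.ker g').liftQ k hle ∘ₗ
    (LinearMap.quotKerEquivOfSurjective g' h₃).symm.toLinearMap, fun y => ?_⟩
  have : (LinearMap.quotKerEquivOfSurjective g' h₃).symm (g' y) = Submodule.Quotient.mk y := by
    rw [LinearEquiv.symm_apply_eq]
    rfl
  exact (congrArg ((LinearMap.ker g').liftQ k hle) this).trans rfl

theorem lift_eq_zero_of_modExact {f : X ⟶ Y} {i : X ⟶ I} {p : I ⟶ C} {w : i ≫ p = 0}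
    (h : modExact R G (ShortComplex.mk i p w)) (x : X) (hx : (biprod.lift f i).hom.hom x = 0) :
    x = 0 := by
  rw [lift_apply, biprodMk_eq_zero] at hx
  exact (modExact_mk_iff.1 h).2.1 x hx.2

theorem modExact_pushout {f : X ⟶ Y} {i : X ⟶ I} {j : Y ⟶ P} {l : I ⟶ P}
    {w₁ : biprod.lift f i ≫ biprod.desc j l = 0} (h₁ : modExact R G (ShortComplex.mk _ _ w₁)) :
    (∀ {p : I ⟶ C} {w : i ≫ p = 0} (_ : modExact R G (ShortComplex.mk i p w)) (q : P ⟶ C)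
      (w₂ : j ≫ q = 0) (_ : l ≫ q = p), modExact R G (ShortComplex.mk j q w₂)) ∧
    (∀ {g : Y ⟶ Z} {w : f ≫ g = 0} (_ : modExact R G (ShortComplex.mk f g w)) (q : P ⟶ Z)
      (w₂ : l ≫ q = 0) (_ : j ≫ q = g), modExact R G (ShortComplex.mk l q w₂)) := by
  obtain ⟨e₁, -, e₃⟩ := modExact_mk_iff.1 h₁
  have w₁' (x : X) : j.hom.hom (f.hom.hom x) + l.hom.hom (i.hom.hom x) = 0 := by
    rw [← desc_apply, ← lift_apply, ← comp_apply, w₁]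
    rfl
  have hsurj (x : P) : ∃ y e, x = j.hom.hom y + l.hom.hom e := by
    obtain ⟨z, rfl⟩ := e₃ x
    obtain ⟨y, e, rfl⟩ := exists_biprodMk z
    exact ⟨y, e, desc_apply _ _ _ _⟩
  constructor
  · rintro p w h q w₂ rfl
    obtain ⟨a₁, a₂, a₃⟩ := modExact_mk_iff.1 h
    have w₂' (y : Y) : q.hom.hom (j.hom.hom y) = 0 := congrArg (fun t => t.hom.hom y) w₂
    refine modExact_mk_iff.2 ⟨fun x hx => ?_, fun y hy => ?_, fun c => ?_⟩
    · obtain ⟨y, e, rfl⟩ := hsurj x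
      rw [map_add, w₂', zero_add] at hx
      obtain ⟨x, rfl⟩ := a₁ e hx
      refine ⟨y - f.hom.hom x, ?_⟩
      rw [map_sub, eq_neg_of_add_eq_zero_left (w₁' x), sub_neg_eq_add]
    · obtain ⟨x, hx⟩ := e₁ (biprodMk y 0) (by rw [desc_apply, hy, map_zero, add_zero])
      rw [lift_apply, biprodMk_inj] at hx
      rw [← hx.1, a₂ x hx.2, map_zero]
    · obtain ⟨e, rfl⟩ := a₃ c
      exact ⟨l.hom.hom e, rfl⟩
  · rintro g w h q w₂ rfl
    obtain ⟨a₁, a₂, a₃⟩ := modExact_mk_iff.1 h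
    have w₂' (y : I) : q.hom.hom (l.hom.hom y) = 0 := congrArg (fun t => t.hom.hom y) w₂
    refine modExact_mk_iff.2 ⟨fun x hx => ?_, fun y hy => ?_, fun c => ?_⟩
    · obtain ⟨y, e, rfl⟩ := hsurj x
      rw [map_add, w₂', add_zero] at hx
      obtain ⟨x, rfl⟩ := a₁ y hx
      refine ⟨e - i.hom.hom x, ?_⟩
      rw [map_sub, eq_neg_of_add_eq_zero_left (w₁' x)]
      abel
    · obtain ⟨x, hx⟩ := e₁ (biprodMk 0 y) (by rw [desc_apply, hy, map_zero, add_zero])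
      rw [lift_apply, biprodMk_inj] at hx
      rw [← hx.2, a₂ x hx.1, map_zero]
    · obtain ⟨e, rfl⟩ := a₃ c
      exact ⟨j.hom.hom e, rfl⟩

/-- The pushout of a monomorphism of modules. -/
theorem exists_modExact_pushout (i : X ⟶ I) (p : I ⟶ C) (w : i ≫ p = 0)
    (h : modExact R G (ShortComplex.mk i p w)) (f : X ⟶ Y) :
    ∃ (P : FGModuleCat.{u} (MonoidAlgebra R G)) (l : I ⟶ P) (j : Y ⟶ P) (q : P ⟶ C)
      (w₁ : biprod.lift f i ≫ biprod.desc j l = 0) (w₂ : j ≫ q = 0),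
      modExact R G (ShortComplex.mk _ _ w₁) ∧ modExact R G (ShortComplex.mk j q w₂) ∧ l ≫ q = p ∧
        ∀ {Z : FGModuleCat.{u} (MonoidAlgebra R G)} (g : Y ⟶ Z) (w' : f ≫ g = 0),
          modExact R G (ShortComplex.mk f g w') →
            ∃ (z : P ⟶ Z) (w'' : l ≫ z = 0), modExact R G (ShortComplex.mk l z w'') := by
  obtain ⟨P, r, w₁, h₁⟩ := exists_modExact_of_injective (biprod.lift f i)
    (lift_eq_zero_of_modExact h)
  obtain ⟨j, l, rfl⟩ : ∃ j l, r = biprod.desc j l :=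
    ⟨biprod.inl ≫ r, biprod.inr ≫ r, biprod.hom_ext' _ _ (by simp) (by simp)⟩
  obtain ⟨q, hq⟩ := exists_desc_of_modExact h₁ (biprod.desc 0 p) (by simp [w])
  have hjq : j ≫ q = 0 := by simpa using biprod.inl ≫= hq
  have hlq : l ≫ q = p := by simpa using biprod.inr ≫= hq
  refine ⟨P, l, j, q, w₁, hjq, h₁, (modExact_pushout (Z := P) h₁).1 h q hjq hlq, hlq,
    fun {Z} g w' h' => ?_⟩
  obtain ⟨z, hz⟩ := exists_desc_of_modExact h₁ (biprod.desc g 0) (by simp [w'])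
  have hjz : j ≫ z = g := by simpa using biprod.inl ≫= hz
  have hlz : l ≫ z = 0 := by simpa using biprod.inr ≫= hz
  exact ⟨z, hlz, (modExact_pushout (C := P) h₁).2 h' z hlz hjz⟩

instance : IsExactStructure (modExact R G) where
  split X Y := modExact_mk_iff.2 ⟨fun z hz => by
      obtain ⟨x, y, rfl⟩ := exists_biprodMk z
      rw [snd_biprodMk] at hz
      exact ⟨x, by rw [hz, inl_apply]⟩,
    fun x hx => by rw [inl_apply, biprodMk_eq_zero] at hx; exact hx.1,
    fun y => ⟨biprodMk 0 y, snd_biprodMk _ _⟩⟩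
  pushout := exists_modExact_pushout
  rotate f g i p w w' h h' k c hk hc w'' := by
    obtain ⟨a₁, a₂, a₃⟩ := modExact_mk_iff.1 h
    obtain ⟨b₁, b₂, b₃⟩ := modExact_mk_iff.1 h'
    have hk' x : k.hom.hom (f.hom.hom x) = i.hom.hom x := congrArg (fun t => t.hom.hom x) hk
    have hc' x : c.hom.hom (g.hom.hom x) = p.hom.hom (k.hom.hom x) :=
      congrArg (fun t => t.hom.hom x) hc
    have hw x : g.hom.hom (f.hom.hom x) = 0 := congrArg (fun t => t.hom.hom x) w
    have hn x : (-p).hom.hom x = - p.hom.hom x := rfl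
    refine modExact_mk_iff.2 ⟨fun x hx => ?_, fun y hy => ?_, fun d => ?_⟩
    · obtain ⟨z, e, rfl⟩ := exists_biprodMk x
      obtain ⟨y, rfl⟩ := a₃ z
      rw [desc_apply, hn, hc', ← sub_eq_add_neg, ← map_sub] at hx
      obtain ⟨x, hx⟩ := b₁ _ hx
      refine ⟨y - f.hom.hom x, ?_⟩
      rw [lift_apply, map_sub, map_sub, hw, sub_zero, hk', hx, sub_sub_cancel]
    · rw [lift_apply, biprodMk_eq_zero] at hy
      obtain ⟨x, rfl⟩ := a₁ y hy.1
      rw [hk'] at hy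
      rw [b₂ x hy.2, map_zero]
    · obtain ⟨e, rfl⟩ := b₃ d
      exact ⟨biprodMk 0 (-e), by rw [desc_apply, hn, map_zero, map_neg, neg_neg, zero_add]⟩

instance : HasInflationComp (modExact R G) where
  id hZ := modExact_mk_iff.2 ⟨fun x _ => ⟨x, rfl⟩, fun _ h => h, fun z =>
    ⟨0, congrArg (fun t => t.hom.hom z) (hZ.eq_of_src 0 (𝟙 _))⟩⟩
  comp {X Y Z I I' P P'} i f i' g r r' w w' h h' := by
    obtain ⟨a₁, a₂, a₃⟩ := modExact_mk_iff.1 h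
    obtain ⟨b₁, b₂, b₃⟩ := modExact_mk_iff.1 h'
    obtain ⟨Q, s, ws, hs⟩ := exists_modExact_of_injective
      (biprod.lift (biprod.lift i (f ≫ i')) (f ≫ g)) (fun x hx => by
        rw [lift_apply, biprodMk_eq_zero, lift_apply, biprodMk_eq_zero] at hx
        refine a₂ x ?_
        have : f.hom.hom x = 0 := b₂ _ (by
          rw [lift_apply, biprodMk_eq_zero]
          exact ⟨hx.1.2, hx.2⟩)
        rw [lift_apply, biprodMk_eq_zero]
        exact ⟨hx.1.1, this⟩)
    obtain ⟨c₁, c₂, c₃⟩ := modExact_mk_iff.1 hs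
    -- On representatives, `a` sends `(e, y)` to `((e, i' y), g y)`, and `b` below sends `((e, e'),
    -- z)` to `(e', z)`.
    obtain ⟨a, ha⟩ := exists_desc_of_modExact h
      (biprod.desc (biprod.inl ≫ biprod.inl) (biprod.lift (i' ≫ biprod.inr) g) ≫ s) (by
        rw [← ws, ← Category.assoc]
        congr 1
        refine biprod.hom_ext _ _ (biprod.hom_ext _ _ ?_ ?_) ?_ <;> simp)
    obtain ⟨b, hb⟩ := exists_desc_of_modExact hs
      (biprod.desc (biprod.desc 0 (biprod.inl ≫ r')) (biprod.inr ≫ r')) (by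
        have h₁ : f ≫ biprod.lift i' g ≫ r' = 0 := by rw [w', comp_zero]
        have h₂ : biprod.lift i' g = i' ≫ biprod.inl + g ≫ biprod.inr := by
          refine biprod.hom_ext _ _ ?_ ?_ <;> simp
        rw [h₂] at h₁
        simpa using h₁)
    have ha' (e : I) (y : Y) : a.hom.hom (r.hom.hom (biprodMk e y)) =
        s.hom.hom (biprodMk (biprodMk e (i'.hom.hom y)) (g.hom.hom y)) := by
      rw [← comp_apply r, ha, comp_apply, desc_apply, comp_apply, inl_apply, inl_apply,
        lift_apply, comp_apply, inr_apply, biprodMk_add, biprodMk_add]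
      simp
    have hb' (e : I) (e' : I') (z : Z) :
        b.hom.hom (s.hom.hom (biprodMk (biprodMk e e') z)) = r'.hom.hom (biprodMk e' z) := by
      rw [← comp_apply s, hb, desc_apply, desc_apply, comp_apply, comp_apply, inl_apply,
        inr_apply, add_assoc, ← map_add, biprodMk_add]
      simp
    refine ⟨Q, s, ws, a, b, ?_, hs, modExact_mk_iff.2 ⟨fun x hx => ?_, fun x hx => ?_,
      fun x => ?_⟩⟩
    · have := epi_of_modExact h
      rw [← cancel_epi r]
      ext x
      obtain ⟨e, y, rfl⟩ := exists_biprodMk x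
      refine (congrArg b.hom.hom (ha' e y)).trans ((hb' _ _ _).trans ?_)
      rw [← lift_apply]
      exact congrArg (fun t => t.hom.hom y) w'
    · obtain ⟨t, rfl⟩ := c₃ x
      obtain ⟨t, z, rfl⟩ := exists_biprodMk t
      obtain ⟨e, e', rfl⟩ := exists_biprodMk t
      rw [hb'] at hx
      obtain ⟨y, hy⟩ := b₁ _ hx
      rw [lift_apply, biprodMk_inj] at hy
      exact ⟨r.hom.hom (biprodMk e y), by rw [ha', hy.1, hy.2]⟩
    · obtain ⟨t, rfl⟩ := a₃ x
      obtain ⟨e, y, rfl⟩ := exists_biprodMk t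
      rw [ha'] at hx
      obtain ⟨x, hx⟩ := c₁ _ hx
      rw [lift_apply, biprodMk_inj, lift_apply, biprodMk_inj] at hx
      have : f.hom.hom x = y := by
        rw [← sub_eq_zero]
        refine b₂ _ ?_
        rw [lift_apply, biprodMk_eq_zero, map_sub, map_sub, sub_eq_zero, sub_eq_zero]
        exact ⟨hx.1.2, hx.2⟩
      rw [← this, ← hx.1.1, ← lift_apply]
      exact congrArg (fun t => t.hom.hom x) w
    · obtain ⟨t, rfl⟩ := b₃ x
      obtain ⟨e', z, rfl⟩ := exists_biprodMk t
      exact ⟨_, hb' 0 e' z⟩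

end Exact

/-! ### The `R`-split exact structure and the comparison of thick subcategories. -/

section Relative

variable {R : Type u} [CommRing R] {G : Type u} [Group G]

attribute [local instance] resModule resModule_isScalarTower

variable {X Y Z W I C P : FGModuleCat.{u} (MonoidAlgebra R G)}

/-- A retraction of `i` alone retracts `(f, i)`, whatever `f` is. This is how an arbitrary map is
made `R`-split. -/
theorem bikExact_lift {f : X ⟶ Y} {i : X ⟶ I} {p : I ⟶ C} {w : i ≫ p = 0}
    (hi : bikExact R G (ShortComplex.mk i p w)) {r : Y ⊞ I ⟶ P} {w' : biprod.lift f i ≫ r = 0}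
    (h : modExact R G (ShortComplex.mk _ _ w')) : bikExact R G (ShortComplex.mk _ _ w') := by
  obtain ⟨-, ρ, hρ⟩ := bikExact_mk_iff.1 hi
  refine bikExact_mk_iff.2 ⟨h,
    ρ ∘ₗ (biprod.snd : Y ⊞ I ⟶ I).hom.hom.restrictScalars R, fun x => ?_⟩
  simp [hρ]

theorem bikExact_pushout {f : X ⟶ Y} {i : X ⟶ I} {j : Y ⟶ P} {l : I ⟶ P}
    {w₁ : biprod.lift f i ≫ biprod.desc j l = 0} (h₁ : modExact R G (ShortComplex.mk _ _ w₁)) :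
    (∀ {p : I ⟶ C} {w : i ≫ p = 0} (_ : bikExact R G (ShortComplex.mk i p w)) {q : P ⟶ C}
      {w₂ : j ≫ q = 0} (_ : modExact R G (ShortComplex.mk j q w₂)),
        bikExact R G (ShortComplex.mk j q w₂)) ∧
    (∀ {g : Y ⟶ Z} {w : f ≫ g = 0} (_ : bikExact R G (ShortComplex.mk f g w)) {q : P ⟶ Z}
      {w₂ : l ≫ q = 0} (_ : modExact R G (ShortComplex.mk l q w₂)),
        bikExact R G (ShortComplex.mk l q w₂)) := by
  let f' : X →ₗ[R] Y := f.hom.hom.restrictScalars R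
  let i' : X →ₗ[R] I := i.hom.hom.restrictScalars R
  let p₁ : ↑(Y ⊞ I) →ₗ[R] Y := (biprod.fst : Y ⊞ I ⟶ Y).hom.hom.restrictScalars R
  let p₂ : ↑(Y ⊞ I) →ₗ[R] I := (biprod.snd : Y ⊞ I ⟶ I).hom.hom.restrictScalars R
  constructor
  · intro p w hi q w₂ h
    obtain ⟨-, ρ, hρ⟩ := bikExact_mk_iff.1 hi
    -- The map `(y, e) ↦ y - f (ρ e)` kills every `(f x, i x)`, so it descends to the pushout and
    -- retracts `j`.
    obtain ⟨t, ht⟩ := exists_linearMap_desc h₁ (p₁ - f' ∘ₗ ρ ∘ₗ p₂) (fun x => by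
      simp [p₁, p₂, f', hρ])
    refine bikExact_mk_iff.2 ⟨h, t, fun y => ?_⟩
    have := ht (biprodMk y 0)
    simpa [p₁, p₂] using this
  · intro p w hi q w₂ h
    obtain ⟨-, ρ, hρ⟩ := bikExact_mk_iff.1 hi
    obtain ⟨t, ht⟩ := exists_linearMap_desc h₁ (p₂ - i' ∘ₗ ρ ∘ₗ p₁) (fun x => by
      simp [p₁, p₂, i', hρ])
    refine bikExact_mk_iff.2 ⟨h, t, fun y => ?_⟩
    have := ht (biprodMk 0 y)
    simpa [p₁, p₂] using this

instance : IsExactStructure (bikExact R G) where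
  split X Y := bikExact_mk_iff.2 ⟨IsExactStructure.split X Y,
    (biprod.fst : X ⊞ Y ⟶ X).hom.hom.restrictScalars R, fun x => by
      simp [inl_apply]⟩
  pushout i p w h f := by
    obtain ⟨P, l, j, q, w₁, w₂, h₁, h₂, h₃, h₄⟩ :=
      IsExactStructure.pushout _ _ _ (bikExact_mk_iff.1 h).1 f
    refine ⟨P, l, j, q, w₁, w₂, bikExact_lift h h₁, (bikExact_pushout (Z := P) h₁).1 h h₂, h₃,
      fun g w' h' => ?_⟩
    obtain ⟨z, w'', hz⟩ := h₄ g w' (bikExact_mk_iff.1 h').1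
    exact ⟨z, w'', (bikExact_pushout (C := P) h₁).2 h' hz⟩
  rotate {X Y Z I C} f g i p w w' h h' k c hk hc w'' := by
    obtain ⟨h₁, ρ, hρ⟩ := bikExact_mk_iff.1 h
    obtain ⟨h₂, ρ', hρ'⟩ := bikExact_mk_iff.1 h'
    let f' : X →ₗ[R] Y := f.hom.hom.restrictScalars R
    let k' : Y →ₗ[R] I := k.hom.hom.restrictScalars R
    let p₁ : ↑(Z ⊞ I) →ₗ[R] Z := (biprod.fst : Z ⊞ I ⟶ Z).hom.hom.restrictScalars R
    let p₂ : ↑(Z ⊞ I) →ₗ[R] I := (biprod.snd : Z ⊞ I ⟶ I).hom.hom.restrictScalars R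
    have hk' x : k.hom.hom (f.hom.hom x) = i.hom.hom x := congrArg (fun t => t.hom.hom x) hk
    -- The map `t` satisfies `t (g y) = y - f (ρ y)`. The missing part `f (ρ y)` is recovered from
    -- the component `k y` by means of `ρ'`, as `k ∘ f = i`.
    obtain ⟨t, ht⟩ := exists_linearMap_desc h₁ (LinearMap.id - f' ∘ₗ ρ) (fun x => by
      simp [f', hρ])
    refine bikExact_mk_iff.2 ⟨IsExactStructure.rotate f g i p w w' h₁ h₂ k c hk hc w'',
      t ∘ₗ p₁ + f' ∘ₗ ρ' ∘ₗ (p₂ - k' ∘ₗ t ∘ₗ p₁), fun y => ?_⟩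
    simp [p₁, p₂, ht, f', k', hk', hρ']

/-- The replacement of a monomorphism by an `R`-split one. -/
theorem exists_bikExact_lift {f : X ⟶ Y} {g : Y ⟶ Z} {w : f ≫ g = 0}
    (h : modExact R G (ShortComplex.mk f g w)) {i : X ⟶ I} {p : I ⟶ C} {w' : i ≫ p = 0}
    (hi : bikExact R G (ShortComplex.mk i p w')) :
    ∃ (P : FGModuleCat.{u} (MonoidAlgebra R G)) (r : Y ⊞ I ⟶ P)
      (w₁ : biprod.lift f i ≫ r = 0) (l : I ⟶ P) (z : P ⟶ Z) (w₂ : l ≫ z = 0),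
      bikExact R G (ShortComplex.mk _ _ w₁) ∧ modExact R G (ShortComplex.mk l z w₂) := by
  obtain ⟨P, l, j, q, w₁, w₂, h₁, h₂, -, h₃⟩ :=
    IsExactStructure.pushout _ _ _ (bikExact_mk_iff.1 hi).1 f
  obtain ⟨z, w₃, hz⟩ := h₃ g w h
  exact ⟨P, _, w₁, l, z, w₃, bikExact_lift hi h₁, hz⟩

/-- The replacement of an epimorphism by an `R`-split monomorphism. -/
theorem exists_bikExact_lift_of_epi {f : X ⟶ Y} {g : Y ⟶ Z} {w : f ≫ g = 0}
    (h : modExact R G (ShortComplex.mk f g w)) {i : Y ⟶ I} {p : I ⟶ C} {w' : i ≫ p = 0}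
    (hi : bikExact R G (ShortComplex.mk i p w')) :
    ∃ (P : FGModuleCat.{u} (MonoidAlgebra R G)) (r : Z ⊞ I ⟶ P)
      (w₁ : biprod.lift g i ≫ r = 0) (l : I ⟶ P) (w₂ : (f ≫ i) ≫ l = 0),
      bikExact R G (ShortComplex.mk _ _ w₁) ∧ modExact R G (ShortComplex.mk _ _ w₂) := by
  obtain ⟨P, l, j, q, w₁, w₂, h₁, -⟩ :=
    IsExactStructure.pushout _ _ _ (bikExact_mk_iff.1 hi).1 g
  obtain ⟨a₁, a₂, a₃⟩ := modExact_mk_iff.1 h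
  obtain ⟨b₁, b₂, b₃⟩ := modExact_mk_iff.1 h₁
  have hgi : g ≫ j = -(i ≫ l) := by
    rw [biprod.lift_desc] at w₁
    exact eq_neg_of_add_eq_zero_left w₁
  have w₃ : (f ≫ i) ≫ l = 0 := by
    have := f ≫= hgi
    rw [reassoc_of% w, zero_comp, Preadditive.comp_neg, eq_comm, neg_eq_zero] at this
    rw [Category.assoc, this]
  refine ⟨P, _, w₁, l, w₃, bikExact_lift hi h₁, modExact_mk_iff.2 ⟨fun e he => ?_, fun x hx => ?_,
    fun z => ?_⟩⟩
  · obtain ⟨y, hy⟩ := b₁ (biprodMk 0 e) (by rw [desc_apply, he, map_zero, add_zero])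
    rw [lift_apply, biprodMk_inj] at hy
    obtain ⟨x, rfl⟩ := a₁ y hy.1
    exact ⟨x, hy.2⟩
  · exact a₂ x ((modExact_mk_iff.1 (bikExact_mk_iff.1 hi).1).2.1 _ hx)
  · obtain ⟨t, rfl⟩ := b₃ z
    obtain ⟨z, e, rfl⟩ := exists_biprodMk t
    obtain ⟨y, rfl⟩ := a₃ z
    refine ⟨e - i.hom.hom y, ?_⟩
    have : j.hom.hom (g.hom.hom y) = -l.hom.hom (i.hom.hom y) :=
      congrArg (fun t => t.hom.hom y) hgi
    rw [desc_apply, map_sub, this]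
    abel

theorem isProjInj_bikExact (hP : IsProjInj (modExact R G) P) : IsProjInj (bikExact R G) P where
  lift S hS := hP.lift S (modExact_of_bikExact hS)
  extend S hS := hP.extend S (modExact_of_bikExact hS)

variable [Finite G]

/-- A relatively projective module is a direct summand of an induced module. -/
theorem exists_retract_extScalars (hP : IsProjInj (bikExact R G) P) :
    ∃ N : FGModuleCat.{u} R, Nonempty (Retract P (extScalars R G N)) := by
  have := Fintype.ofFinite G
  have : Module.Finite R P := Module.Finite.trans (MonoidAlgebra R G) P
  let N : FGModuleCat.{u} R := FGModuleCat.of R P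
  let S := coindComplex P N LinearMap.id
  let ρ : S.X₂ →ₗ[R] P :=
    { toFun := coeffOne (R := R) (G := G) (N := P)
      map_add' := map_add _
      map_smul' := coeffOne_algebraMap_smul }
  have hS : bikExact R G S := bikExact_mk_iff.2
    ⟨modExact_coindComplex P N LinearMap.id Function.injective_id, ρ,
      fun x => coeffOne_coind (G := G) (LinearMap.id (R := R) (M := P)) x⟩
  obtain ⟨l, hl⟩ := hP.extend S hS (𝟙 P)
  exact ⟨N, ⟨⟨S.f, l, hl⟩⟩⟩

variable (R G) in
/-- The quotient functor from the stable category to the relative stable category. -/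
def stmodToStbik [IsArtinianRing R] [Module.Injective R R] : Stmod R G ⥤ Stbik R G :=
  CategoryTheory.Quotient.lift _ (toStable (bikExact R G))
    fun _ _ _ _ ⟨P, a, b, hP, h⟩ =>
      CategoryTheory.Quotient.sound _ ⟨P, a, b, isProjInj_bikExact hP, h⟩

variable [IsArtinianRing R] [Module.Injective R R]

/-- The rest of the argument uses only this property of `𝒦` and its thickness; the induced modules
enter nowhere else. -/
theorem thickK_projInj (hP : IsProjInj (bikExact R G) P) :
    (thickK R G).1 ((toStable (modExact R G)).obj P) := by
  obtain ⟨N, ⟨r⟩⟩ := exists_retract_extScalars hP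
  exact (thickK R G).2.retract _ _ (r.map (toStable (modExact R G))) fun L hL => hL _ ⟨N, rfl⟩

/-- Thick subcategories of the stable category which contain `𝒦` are thick in the relative stable
category. -/
theorem isThick_bik {M : ObjectProperty (Stmod R G)} (hM : IsThick (distTriangles (modExact R G)) M)
    (hKM : (thickK R G).1 ≤ M) : IsThick (distTriangles (bikExact R G))
      fun X => M ((toStable (modExact R G)).obj X.as) := by
  have retract (X Y : Stbik R G) (r : Retract X Y) (hY : M ((toStable (modExact R G)).obj Y.as)) :
      M ((toStable (modExact R G)).obj X.as) := by
    obtain ⟨i, s, hr⟩ := r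
    obtain ⟨i, rfl⟩ := (toStable (bikExact R G)).map_surjective (X := X.as) (Y := Y.as) i
    obtain ⟨s, rfl⟩ := (toStable (bikExact R G)).map_surjective (X := Y.as) (Y := X.as) s
    change (toStable (bikExact R G)).map i ≫ (toStable (bikExact R G)).map s =
      𝟙 ((toStable (bikExact R G)).obj X.as) at hr
    rw [← (toStable (bikExact R G)).map_comp, ← (toStable (bikExact R G)).map_id, eq_comm,
      toStable_map_eq_iff] at hr
    obtain ⟨P, a, b, hP, h⟩ := hr
    -- A retract in the relative stable category is an honest retract of modules after adding the
    -- relatively projective `P`, which belongs to `M`.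
    let r' : Retract X.as (Y.as ⊞ P) := ⟨biprod.lift i a, biprod.desc s b, by
      rw [biprod.lift_desc, ← h, add_sub_cancel]⟩
    exact hM.retract _ _ (r'.map (toStable (modExact R G)))
      (hM.biprod hY (hKM _ (thickK_projInj hP)))
  refine ⟨fun X hX => ?_, fun X => ?_, ?_, retract⟩
  · refine retract X ((toStable (bikExact R G)).obj (hull (bikExact R G) X.as).I)
      ⟨hX.to_ _, hX.from_ _, hX.eq_of_src _ _⟩ ?_
    exact hKM _ (thickK_projInj (hull (bikExact R G) X.as).projInj)
  · let H := hull (bikExact R G) X.as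
    have hI := hKM _ (thickK_projInj H.projInj)
    have hH := modExact_of_bikExact H.mem
    exact ⟨hM.first _ hH hI, fun h => hM.third _ hH h hI⟩
  · rintro t ⟨S, k, c, hS, hk, hc, a, b, d, -⟩ h₁ h₂
    refine retract _ ((toStable _).obj S.X₃) ⟨d.hom, d.inv, d.hom_inv_id⟩ ?_
    refine hM.third S (modExact_of_bikExact hS) ?_ ?_
    · exact retract ((toStable _).obj S.X₁) _ ⟨a.inv, a.hom, a.inv_hom_id⟩ h₁
    · exact retract ((toStable _).obj S.X₂) _ ⟨b.inv, b.hom, b.inv_hom_id⟩ h₂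

section

variable {L : ObjectProperty (Stbik R G)} (hL : IsThick (distTriangles (bikExact R G)) L)
  (hKL : thickK' R G ≤ L)
include hL hKL

/-- The sequence need not be `R`-split, but `Y ⟶ Z ⊞ I` is, for a relative hull `I` of `Y`. Its
cokernel is `I` modulo `X`, which lies in `𝒦` and hence in `L`. -/
theorem iff_of_modExact {f : X ⟶ Y} {g : Y ⟶ Z} {w : f ≫ g = 0}
    (h : modExact R G (ShortComplex.mk f g w)) (hX : (thickK R G).1 ((toStable _).obj X)) :
    L ((toStable _).obj Y) ↔ L ((toStable _).obj Z) := by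
  let H := hull (bikExact R G) Y
  obtain ⟨P, r, w₁, l, w₂, h₁, h₂⟩ := exists_bikExact_lift_of_epi h H.mem
  have hP : L ((toStable _).obj P) :=
    hKL _ ((thickK R G).2.third _ h₂ hX (thickK_projInj H.projInj))
  rw [← hL.biprod_iff Z H.projInj]
  exact ⟨fun hY => hL.second _ h₁ hY hP, fun hZ => hL.first _ h₁ hZ hP⟩

/-- Thick subcategories of the relative stable category which contain `𝒦'` are thick in the stable
category. -/
theorem isThick_mod : IsThick (distTriangles (modExact R G))
    fun X => L ((toStable (bikExact R G)).obj X.as) := by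
  have retract (X Y : Stmod R G) (r : Retract X Y) (hY : L ((toStable (bikExact R G)).obj Y.as)) :
      L ((toStable (bikExact R G)).obj X.as) :=
    hL.retract _ _ (r.map (stmodToStbik R G)) hY
  refine ⟨fun X hX => hKL _ ((thickK R G).2.zero _ hX), fun X => ?_, ?_, retract⟩
  · let H := hull (modExact R G) X.as
    let H' := hull (bikExact R G) X.as
    -- The absolute hull is made `R`-split by adding the relative one. The new cokernel `P` is an
    -- extension of the absolute cosyzygy by `H'.I ∈ 𝒦`, and the middle term is relatively
    -- projective.
    obtain ⟨P, r, w₁, l, z, w₂, h₁, h₂⟩ := exists_bikExact_lift H.mem H'.mem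
    have hI : L ((toStable _).obj (H.I ⊞ H'.I)) :=
      (hL.biprod_iff _ H'.projInj).2 (hL.projInj (isProjInj_bikExact H.projInj))
    refine (iff_of_modExact hL hKL h₂ (thickK_projInj H'.projInj)).symm.trans ?_
    exact ⟨hL.first _ h₁ hI, fun h => hL.third _ h₁ h hI⟩
  · rintro t ⟨S, k, c, hS, hk, hc, a, b, d, -⟩ h₁ h₂
    refine retract _ ((toStable _).obj S.X₃) ⟨d.hom, d.inv, d.hom_inv_id⟩ ?_
    have h₁' := retract ((toStable _).obj S.X₁) _ ⟨a.inv, a.hom, a.inv_hom_id⟩ h₁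
    have h₂' := retract ((toStable _).obj S.X₂) _ ⟨b.inv, b.hom, b.inv_hom_id⟩ h₂
    let H' := hull (bikExact R G) S.X₁
    obtain ⟨P, r, w₁, l, z, w₂, h₁, h₂⟩ := exists_bikExact_lift hS H'.mem
    refine (iff_of_modExact hL hKL h₂ (thickK_projInj H'.projInj)).1 ?_
    exact hL.third _ h₁ h₁' ((hL.biprod_iff _ H'.projInj).2 h₂')

end

/-- The correspondence between thick subcategories containing `𝒦'` and `𝒦`: the objects are
the same. -/
def thickOrderIso : {L : Thick (distTriangles (bikExact R G)) // thickK' R G ≤ L.1} ≃o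
    {M : Thick (distTriangles (modExact R G)) // thickK R G ≤ M} where
  toFun L := ⟨⟨_, isThick_mod L.1.2 L.2⟩, fun _ hX => L.2 _ hX⟩
  invFun M := ⟨⟨_, isThick_bik M.1.2 M.2⟩, fun _ hX => M.2 _ hX⟩
  left_inv _ := rfl
  right_inv _ := rfl
  map_rel_iff' := ⟨fun h _ hX => h ((toStable (modExact R G)).obj _) hX,
    fun h _ hX => h ((toStable (bikExact R G)).obj _) hX⟩

end Relative

/-! ### The mutually inverse functors between the Verdier quotients. -/

section Equivalence

variable (R : Type u) [CommRing R] (G : Type u) [Group G] [Finite G] [IsArtinianRing R]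
  [Module.Injective R R]

/-- The objects of `𝒦`. -/
def objK : ObjectProperty (Stmod R G) := (thickK R G).1

theorem isThick_objK : IsThick (distTriangles (modExact R G)) (objK R G) := (thickK R G).2

/-- The Verdier quotient of the stable category by `𝒦`. -/
abbrev StmodQuot := VerdierQuotient (distTriangles (modExact R G)) (objK R G)

/-- The Verdier quotient of the relative stable category by `𝒦'`. -/
abbrev StbikQuot := VerdierQuotient (distTriangles (bikExact R G)) (thickK' R G)

/-- The quotient functor by `𝒦`. -/
abbrev stmodQ : Stmod R G ⥤ StmodQuot R G := verdierQ _ (objK R G)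

/-- The quotient functor by `𝒦'`. -/
abbrev stbikQ : Stbik R G ⥤ StbikQuot R G := verdierQ _ (thickK' R G)

theorem isThick_thickK' : IsThick (distTriangles (bikExact R G)) (thickK' R G) :=
  isThick_bik (isThick_objK R G) le_rfl

theorem stmodQ_inverts : (coneIn (distTriangles (modExact R G)) (objK R G)).IsInvertedBy
    (stmodQ R G) :=
  MorphismProperty.Q_inverts _

theorem stbikQ_inverts : (coneIn (distTriangles (bikExact R G)) (thickK' R G)).IsInvertedBy
    (stbikQ R G) :=
  MorphismProperty.Q_inverts _

/-- The functor from the relative stable category to the quotient of the stable category. -/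
def stbikToQuot : Stbik R G ⥤ StmodQuot R G :=
  CategoryTheory.Quotient.lift _ (toStable (modExact R G) ⋙ stmodQ R G)
    fun _ _ f g ⟨_, a, b, hP, h⟩ =>
      map_eq_of_sub_eq (stmodQ_inverts R G) (thickK_projInj hP) f g a b h

theorem stbikToQuot_inverts :
    (coneIn (distTriangles (bikExact R G)) (thickK' R G)).IsInvertedBy (stbikToQuot R G) :=
  (isThick_thickK' R G).isInvertedBy fun S hS h =>
    isIso_map_f (stmodQ_inverts R G) S (modExact_of_bikExact hS) h

theorem stmodToStbik_comp_inverts :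
    (coneIn (distTriangles (modExact R G)) (objK R G)).IsInvertedBy
      (stmodToStbik R G ⋙ stbikQ R G) :=
  (isThick_objK R G).isInvertedBy fun S hS h => by
    let H := hull (bikExact R G) S.X₁
    obtain ⟨P, r, w₁, l, z, w₂, h₁, h₂⟩ := exists_bikExact_lift hS H.mem
    have hP : objK R G ((toStable _).obj P) :=
      (isThick_objK R G).second _ h₂ (thickK_projInj H.projInj) h
    have := isIso_map_f (stbikQ_inverts R G) _ h₁ hP
    have := isIso_map_fst (stbikQ_inverts R G)
      ((isThick_thickK' R G).projInj H.projInj) S.X₂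
    change IsIso ((stbikQ R G).map ((toStable (bikExact R G)).map S.f))
    -- The first factor is `R`-split with cokernel in `𝒦`, and the second discards a relatively
    -- projective summand.
    have h₃ : S.f = biprod.lift S.f H.i ≫ biprod.fst := by simp
    rw [h₃, Functor.map_comp, Functor.map_comp]
    infer_instance

/-- The functor induced by the identity of the category of modules. -/
def quotFunctor : StbikQuot R G ⥤ StmodQuot R G :=
  Localization.Construction.lift (stbikToQuot R G) (stbikToQuot_inverts R G)

/-- The inverse of the functor `quotFunctor`. -/
def quotInverse : StmodQuot R G ⥤ StbikQuot R G :=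
  Localization.Construction.lift (stmodToStbik R G ⋙ stbikQ R G) (stmodToStbik_comp_inverts R G)

theorem toStable_comp_quotFunctor :
    toStable (bikExact R G) ⋙ stbikQ R G ⋙ quotFunctor R G =
      toStable (modExact R G) ⋙ stmodQ R G := by
  rw [quotFunctor, Localization.Construction.fac]
  exact CategoryTheory.Quotient.lift_spec _ _ _

theorem toStable_comp_quotInverse :
    toStable (modExact R G) ⋙ stmodQ R G ⋙ quotInverse R G =
      toStable (bikExact R G) ⋙ stbikQ R G := by
  rw [quotInverse, Localization.Construction.fac, ← Functor.assoc]
  exact congrArg (· ⋙ stbikQ R G) (CategoryTheory.Quotient.lift_spec _ _ _)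

/-- By the uniqueness of functors out of a localization and out of a quotient category, equality may
be tested after precomposing with the projection from modules. -/
theorem quotFunctor_comp_quotInverse : quotFunctor R G ⋙ quotInverse R G = 𝟭 _ := by
  refine Localization.Construction.uniq _ _ (CategoryTheory.Quotient.lift_unique' _ _ _ ?_)
  rw [← Functor.assoc, ← Functor.assoc, Functor.assoc (toStable _), toStable_comp_quotFunctor,
    Functor.assoc, toStable_comp_quotInverse, Functor.comp_id]

theorem quotInverse_comp_quotFunctor : quotInverse R G ⋙ quotFunctor R G = 𝟭 _ := by
  refine Localization.Construction.uniq _ _ (CategoryTheory.Quotient.lift_unique' _ _ _ ?_)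
  rw [← Functor.assoc, ← Functor.assoc, Functor.assoc (toStable _), toStable_comp_quotInverse,
    Functor.assoc, toStable_comp_quotFunctor, Functor.comp_id]

/-- The equivalence of Verdier quotients. -/
def quotEquivalence : StbikQuot R G ≌ StmodQuot R G :=
  CategoryTheory.Equivalence.mk (quotFunctor R G) (quotInverse R G)
    (eqToIso (quotFunctor_comp_quotInverse R G).symm) (eqToIso (quotInverse_comp_quotFunctor R G))

/-- The suspension of the quotient of the stable category. -/
def stmodQuotSuspension :
    QuotientSuspension (distTriangles (modExact R G)) (objK R G) where
  functor := Localization.Construction.lift (suspension _ ⋙ stmodQ R G)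
    (isInvertedBy_suspension_comp (stmodQ_inverts R G) (isThick_objK R G))
  comm := eqToIso (Localization.Construction.fac _ _).symm

variable {R G}

theorem exists_cosyzygyComparison (X : FGModuleCat.{u} (MonoidAlgebra R G)) :
    ∃ (k : (hull (bikExact R G) X).I ⟶ (hull (modExact R G) X).I)
      (c : (hull (bikExact R G) X).C ⟶ (hull (modExact R G) X).C),
      (hull (bikExact R G) X).i ≫ k = (hull (modExact R G) X).i ∧
      (hull (bikExact R G) X).p ≫ c = k ≫ (hull (modExact R G) X).p :=
  exists_connecting (E := modExact R G)
    (ShortComplex.mk _ _ (hull (bikExact R G) X).w) (modExact_of_bikExact (hull _ X).mem)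

/-- The comparison of relative and absolute cosyzygies. -/
def cosyzygyComparison (X : FGModuleCat.{u} (MonoidAlgebra R G)) :
    (hull (bikExact R G) X).C ⟶ (hull (modExact R G) X).C :=
  (exists_cosyzygyComparison X).choose_spec.choose

theorem cosyzygyComparison_spec (X : FGModuleCat.{u} (MonoidAlgebra R G)) :
    ∃ k : (hull (bikExact R G) X).I ⟶ (hull (modExact R G) X).I,
      (hull (bikExact R G) X).i ≫ k = (hull (modExact R G) X).i ∧
      (hull (bikExact R G) X).p ≫ cosyzygyComparison X = k ≫ (hull (modExact R G) X).p :=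
  ⟨_, (exists_cosyzygyComparison X).choose_spec.choose_spec⟩

/-- The comparison is the absolute connecting morphism of the relative hull sequence, whose middle
term is relatively projective and so in `𝒦`. -/
instance isIso_cosyzygyComparison (X : FGModuleCat.{u} (MonoidAlgebra R G)) :
    IsIso ((stmodQ R G).map ((toStable _).map (cosyzygyComparison X))) := by
  obtain ⟨k, hk, hc⟩ := cosyzygyComparison_spec X
  exact isIso_map_connecting (stmodQ_inverts R G) (isThick_objK R G)
    (modExact_of_bikExact (hull _ X).mem) (thickK_projInj (hull _ X).projInj) k _ hk hc

/-- The comparison of relative and absolute cosyzygies is natural in the stable category. -/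
theorem cosyzygyComparison_naturality {X Y : FGModuleCat.{u} (MonoidAlgebra R G)} (f : X ⟶ Y) :
    (toStable (modExact R G)).map (cosyzygyMap (bikExact R G) f ≫ cosyzygyComparison Y) =
      (toStable (modExact R G)).map (cosyzygyComparison X ≫ cosyzygyMap (modExact R G) f) := by
  obtain ⟨a, ha, ha'⟩ := isCosyzygyMap_cosyzygyMap (bikExact R G) f
  obtain ⟨b, hb, hb'⟩ := isCosyzygyMap_cosyzygyMap (modExact R G) f
  obtain ⟨k, hk, hk'⟩ := cosyzygyComparison_spec X
  obtain ⟨l, hl, hl'⟩ := cosyzygyComparison_spec Y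
  rw [toStable_map_eq_iff]
  have hH := modExact_of_bikExact (hull (bikExact R G) X).mem
  -- Both composites of hull maps extend the same map on `X`. Their difference factors through the
  -- cosyzygy, so the induced maps differ by one through the absolute hull of `Y`.
  obtain ⟨m, hm⟩ := exists_desc_of_mem hH (a ≫ l - k ≫ b) (by
    rw [Preadditive.comp_sub, reassoc_of% ha, hl, reassoc_of% hk, hb, sub_self])
  refine ⟨_, m, (hull (modExact R G) Y).p, (hull (modExact R G) Y).projInj, ?_⟩
  have := epi_of_mem hH
  rw [← cancel_epi (hull (bikExact R G) X).p, Preadditive.comp_sub, reassoc_of% ha', hl',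
    reassoc_of% hk', hb', reassoc_of% hm, Preadditive.sub_comp, Category.assoc, Category.assoc]

end Equivalence

/-! ### Compatibility with suspensions and triangles. -/

section Exactness

variable {R : Type u} [CommRing R] {G : Type u} [Group G] [Finite G] [IsArtinianRing R]
  [Module.Injective R R]

theorem quotFunctor_map {X Y : FGModuleCat.{u} (MonoidAlgebra R G)} (f : X ⟶ Y) :
    (quotFunctor R G).map ((stbikQ R G).map ((toStable (bikExact R G)).map f)) =
      (stmodQ R G).map ((toStable (modExact R G)).map f) :=
  eq_of_heq (Functor.hcongr_hom (toStable_comp_quotFunctor R G) f)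

theorem stmodQuotSuspension_map {X Y : Stmod R G} (f : X ⟶ Y) :
    (stmodQuotSuspension R G).functor.map ((stmodQ R G).map f) =
      (stmodQ R G).map ((suspension (modExact R G)).map f) :=
  eq_of_heq (Functor.hcongr_hom (Localization.Construction.fac (suspension _ ⋙ stmodQ R G)
    (isInvertedBy_suspension_comp (stmodQ_inverts R G) (isThick_objK R G))) f)

theorem stmodQuotSuspension_comm_app (X : Stmod R G) :
    (stmodQuotSuspension R G).comm.hom.app X = 𝟙 ((stmodQ R G).obj ((suspension _).obj X)) :=
  eqToHom_app (Localization.Construction.fac (suspension _ ⋙ stmodQ R G)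
    (isInvertedBy_suspension_comp (stmodQ_inverts R G) (isThick_objK R G))).symm X

variable (R G) in
/-- The suspensions of the relative stable category and of the stable category agree in the
quotient. -/
def suspensionComparison : (suspension (bikExact R G) ⋙ stbikQ R G) ⋙ quotFunctor R G ≅
    (stbikQ R G ⋙ quotFunctor R G) ⋙ (stmodQuotSuspension R G).functor :=
  NatIso.ofComponents
    (fun X => @asIso _ _ _ _ ((stmodQ R G).map ((toStable _).map (cosyzygyComparison X.as)))
      (isIso_cosyzygyComparison X.as))
    (by
      intro X Y f
      obtain ⟨f, rfl⟩ := (toStable _).map_surjective (X := X.as) (Y := Y.as) f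
      have h : (stmodQ R G).map ((toStable _).map (cosyzygyMap (bikExact R G) f)) ≫
          (stmodQ R G).map ((toStable _).map (cosyzygyComparison Y.as)) =
          (stmodQ R G).map ((toStable _).map (cosyzygyComparison X.as)) ≫
            (stmodQ R G).map ((toStable _).map (cosyzygyMap (modExact R G) f)) := by
        rw [← Functor.map_comp, ← Functor.map_comp, ← Functor.map_comp, ← Functor.map_comp,
          cosyzygyComparison_naturality]
      have h' := (congrArg (stmodQuotSuspension R G).functor.map (quotFunctor_map f)).trans
        (stmodQuotSuspension_map _)
      exact (congrArg (· ≫ _) (quotFunctor_map (cosyzygyMap _ f))).trans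
        (h.trans (congrArg (_ ≫ ·) h'.symm)))

variable (R G) in
/-- The suspension of the quotient of the relative stable category, transported along the
equivalence. -/
def stbikQuotSuspension :
    QuotientSuspension (distTriangles (bikExact R G)) (thickK' R G) where
  functor := (quotEquivalence R G).functor ⋙ (stmodQuotSuspension R G).functor ⋙
    (quotEquivalence R G).inverse
  comm := Functor.fullyFaithfulCancelRight (quotEquivalence R G).functor
    (suspensionComparison R G ≪≫
      Functor.isoWhiskerLeft ((stbikQ R G ⋙ quotFunctor R G) ⋙ (stmodQuotSuspension R G).functor)
        (quotEquivalence R G).counitIso.symm)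

variable (R G) in
/-- The equivalence commutes with the suspensions. -/
def quotEquivalenceComm : (stbikQuotSuspension R G).functor ⋙ (quotEquivalence R G).functor ≅
    (quotEquivalence R G).functor ⋙ (stmodQuotSuspension R G).functor :=
  Functor.isoWhiskerLeft ((quotEquivalence R G).functor ⋙ (stmodQuotSuspension R G).functor)
    (quotEquivalence R G).counitIso

/-- The counit inserted to transport the suspension cancels against the one in
`quotEquivalenceComm`, leaving the cosyzygy comparison. -/
theorem map_stbikQuotSuspension_comm (X : Stbik R G) :
    (quotEquivalence R G).functor.map ((stbikQuotSuspension R G).comm.hom.app X) ≫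
      (quotEquivalenceComm R G).hom.app ((stbikQ R G).obj X) =
        (suspensionComparison R G).hom.app X := by
  simp only [stbikQuotSuspension, Functor.fullyFaithfulCancelRight_hom_app, Functor.map_preimage,
    quotEquivalenceComm]
  erw [Category.assoc]
  refine (congrArg (_ ≫ ·) ?_).trans (Category.comp_id _)
  exact (quotEquivalence R G).counitIso.inv_hom_id_app _

variable (R G) in
theorem isExactFunctor_quotEquivalence : IsExactFunctor (quotEquivalence R G).functor := by
  refine ⟨stbikQuotSuspension R G, stmodQuotSuspension R G, quotEquivalenceComm R G, ?_⟩
  rintro t ⟨t₀, ⟨S, k, c, hS, hk, hc, ht₀⟩, ht⟩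
  obtain ⟨l, hl, hl'⟩ := cosyzygyComparison_spec S.X₁
  -- The target triangle comes from the same sequence `S`, now viewed as merely exact. Its
  -- connecting morphism is the relative one followed by the comparison of cosyzygies.
  refine ⟨_, standardTriangle_mem (E := modExact R G) S (modExact_of_bikExact hS) (k ≫ l)
    (c ≫ cosyzygyComparison S.X₁) ?_ ?_, ((ht.trans (ht₀.map _ _)).map _ _).trans ?_⟩
  · rw [reassoc_of% hk, hl]
  · rw [reassoc_of% hc, hl', Category.assoc]
  refine ⟨Iso.refl _, Iso.refl _, Iso.refl _, ?_, ?_, ?_⟩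
  · exact (Category.comp_id _).trans ((quotFunctor_map S.f).trans (Category.id_comp _).symm)
  · exact (Category.comp_id _).trans ((quotFunctor_map S.g).trans (Category.id_comp _).symm)
  · have h₁ : (quotEquivalence R G).functor.map ((stbikQ R G).map
        ((toStable (bikExact R G)).map (-c)) ≫
          (stbikQuotSuspension R G).comm.hom.app ((toStable _).obj S.X₁)) ≫
        (quotEquivalenceComm R G).hom.app ((stbikQ R G).obj ((toStable _).obj S.X₁)) =
        (stmodQ R G).map ((toStable _).map (-(c ≫ cosyzygyComparison S.X₁))) := by
      have h : (stmodQ R G).map ((toStable _).map (-c)) ≫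
          (stmodQ R G).map ((toStable _).map (cosyzygyComparison S.X₁)) =
          (stmodQ R G).map ((toStable _).map (-(c ≫ cosyzygyComparison S.X₁))) := by
        rw [← Preadditive.neg_comp, Functor.map_comp, Functor.map_comp]
      refine (congrArg (· ≫ _) (Functor.map_comp _ _ _)).trans ((Category.assoc _ _ _).trans ?_)
      refine (congrArg (_ ≫ ·) (map_stbikQuotSuspension_comm
        ((toStable (bikExact R G)).obj S.X₁))).trans ?_
      exact (congrArg (· ≫ _) (quotFunctor_map (-c))).trans h
    have h₂ : (stmodQ R G).map ((toStable _).map (-(c ≫ cosyzygyComparison S.X₁))) ≫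
        (stmodQuotSuspension R G).comm.hom.app ((toStable _).obj S.X₁) =
        (stmodQ R G).map ((toStable _).map (-(c ≫ cosyzygyComparison S.X₁))) :=
      (congrArg (fun x => (stmodQ R G).map ((toStable _).map (-(c ≫ cosyzygyComparison S.X₁))) ≫ x)
        (stmodQuotSuspension_comm_app _)).trans (Category.comp_id _)
    refine Eq.trans ?_ (h₁.trans (h₂.symm.trans (Category.id_comp _).symm))
    exact (congrArg (_ ≫ ·) (CategoryTheory.Functor.map_id _ _)).trans (Category.comp_id _)

end Exactness
end StableCat
end

open StableCat
theorem corollary3p5 (R : Type u) [CommRing R] [IsArtinianRing R] [Module.Injective R R]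
    (G : Type u) [Group G] [Finite G] :
    IsThick (distTriangles (bikExact R G)) (thickK' R G) ∧
    ∃ φ : VerdierQuotient (distTriangles (bikExact R G)) (thickK' R G) ≌
        VerdierQuotient (distTriangles (modExact R G)) (thickK R G).1,
      IsExactFunctor φ.functor ∧
      Nonempty (toStable (bikExact R G) ⋙ verdierQ _ (thickK' R G) ⋙ φ.functor ≅
        toStable (modExact R G) ⋙ verdierQ _ (thickK R G).1) ∧
      ∃ e : {L : Thick (distTriangles (bikExact R G)) // thickK' R G ≤ L.1} ≃o
          {M : Thick (distTriangles (modExact R G)) // thickK R G ≤ M},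
        ∀ (L : {L : Thick (distTriangles (bikExact R G)) // thickK' R G ≤ L.1}) (X : Stmod R G),
          (e L).1.1 X ↔ (L.1.1.map (verdierQ _ (thickK' R G) ⋙ φ.functor))
            ((verdierQ _ (thickK R G).1).obj X) := by
  refine ⟨isThick_thickK' R G, quotEquivalence R G, isExactFunctor_quotEquivalence R G,
    ⟨eqToIso (toStable_comp_quotFunctor R G)⟩, thickOrderIso, fun L X => ⟨fun hX => ?_, ?_⟩⟩
  · exact ⟨(toStable _).obj X.as, hX, ⟨Iso.refl _⟩⟩
  -- Since `φ` is the identity on modules, this is an isomorphism in `stmod/𝒦` between `X` and an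
  -- object of the thick subcategory matching `L`, which contains `𝒦`.
  · rintro ⟨Y, hY, ⟨i⟩⟩
    let i' : (stmodQ R G).obj ((toStable _).obj Y.as) ≅ (stmodQ R G).obj X := i
    exact IsThick.of_verdierQ_iso (thickOrderIso L).1.2 (thickOrderIso L).2 i'.symm hY
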